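/- Let $\Bbbk$ be an algebraically closed field of characteristic $0$, let $m\ge 1$, $n\ge 0$, $t\ge 0$ be integers, and let $q\in\Bbbk^\times$ with $q^2\neq 1$. Put $[a]=\frac{q^a-q^{-a}}{q-q^{-1}}$, and let $\mathbf{char}(q)$ be the least $\ell\ge1$ with $[\ell]=0$, or $0$ if there is none ($q$ generic). **The spaces.** Let $\mathcal A_q(m)$ be the quantum divided power algebra, with basis $x^{(\beta)}$ ($\beta\in\mathbb Z_{\ge0}^m$) and product $x^{(\beta)}x^{(\gamma)}=q^{\sum_{i>j}\beta_i\gamma_j}\prod_i{\beta_i+\gamma_i\brack\beta_i}x^{(\beta+\gamma)}$; let $\Lambda_{q^{-1}}(n)$ be the algebra generated by $x_{m+1},\dots,x_{m+n}$ with relations $x_i^2=0$, $x_jx_i+q\,x_ix_j=0$ ($i<j$); and let $\Omega_q(m|n)=\mathcal A_q(m)\otimes\Lambda_{q^{-1}}(n)$ be the quantum Grassmann superalgebra, with product $(x^{(\alpha)}\otimes x^{\mu})(x^{(\beta)}\otimes x^{\nu})=q^{|\mu||\beta|}x^{(\alpha)}x^{(\beta)}\otimes x^\mu x^\nu$ for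 monomials. If $\mathbf{char}(q)=\ell\ge3$, let $\mathcal A_q(m,\mathbf 1)$ be spanned by the $x^{(\beta)}$ with all $\beta_i\le\ell-1$, and $\Omega_q(m|n,\mathbf 1)=\mathcal A_q(m,\mathbf 1)\otimes\Lambda_{q^{-1}}(n)$. All these spaces are graded by total degree, and $(\cdot)^{(t)}$ denotes the component of degree $t$. **The algebras.** Let $I_0=\{1,\dots,m\}$, and equip $\mathbb Z^{m+n}$ (basis $\epsilon_i$) with the form $(\epsilon_i,\epsilon_j)=\pm\delta_{ij}$, with sign $+$ iff $i\in I_0$. Let $\alpha_j=\epsilon_j-\epsilon_{j+1}$ and $\omega_i=\epsilon_1+\dots+\epsilon_i$, $\omega_0=0$. Let $\mathfrak g=\mathfrak{gl}(m|n)$ or $\mathfrak{sl}(m|n)$, and let $L=\mathbb Z^{m+n}$ or $L=\sum_j\mathbb Z\alpha_j$ respectively. Let $\mathcal U_q$ be the bosonization of the quantum superalgebra $U_q(\mathfrak g)$: it is generated by $E_j,F_j$ ($1\le j<m+n$), $K_\gamma$ ($\gamma\in L$) and $\sigma$, with relations $K_0=1$, $K_\gamma K_\delta=K_{\gamma+\delta}$,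 $K_\gamma E_j=q^{(\gamma,\alpha_j)}E_jK_\gamma$, $K_\gamma F_j=q^{-(\gamma,\alpha_j)}F_jK_\gamma$; $E_iF_j-(-1)^{p_ip_j}F_jE_i=\delta_{ij}\frac{K_{\alpha_i}-K_{-\alpha_i}}{q_i-q_i^{-1}}$, where $p_i=\delta_{im}$ and $q_i=q$ for $i\le m$, $q_i=q^{-1}$ for $i>m$; for $X=E$ and for $X=F$: $X_iX_j=X_jX_i$ if $|i-j|>1$, $X_i^2X_j-(q+q^{-1})X_iX_jX_i+X_jX_i^2=0$ if $|i-j|=1$, $i\ne m$, $X_m^2=0$, and $X_{m-1}X_mX_{m+1}X_m+X_mX_{m-1}X_mX_{m+1}+X_{m+1}X_mX_{m-1}X_m+X_mX_{m+1}X_mX_{m-1}-(q+q^{-1})X_mX_{m-1}X_{m+1}X_m=0$ (each whenever its indices exist); $\sigma^2=1$, $\sigma K_\gamma\sigma=K_\gamma$, $\sigma X_j\sigma=(-1)^{p_j}X_j$. If $\mathbf{char}(q)=\ell\ge3$, let $u_q$ be the quotient of $\mathcal U_q$ by $E_j^\ell$, $F_j^\ell$ ($j\ne m$) and $K_\gamma^{2\ell}-1$.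 **The action.** $\mathcal U_q$ acts on $\Omega_q(m|n)$, and $u_q$ on $\Omega_q(m|n,\mathbf 1)$, by $E_j=x_j\partial_{j+1}\sigma_j$, $F_j=\sigma_j^{-1}x_{j+1}\partial_j$, $K_\gamma=q^{(w,\gamma)}$ on monomials of weight (exponent vector) $w$, and $\sigma=(-1)^{|\mu|}$ on $x^{(\alpha)}\otimes x^\mu$. Here $x_j$ is left multiplication, and on $x^{(\beta)}\otimes x^\mu$: $\sigma_j$ is the scalar $q^{\beta_j}$ if $j\in I_0$ and $(-q)^{\mu_j}$ otherwise; $\partial_i(x^{(\beta)}\otimes x^\mu)=q^{-\sum_{s<i}\beta_s}x^{(\beta-\epsilon_i)}\otimes x^\mu$ for $i\in I_0$, and $\partial_i(x^{(\beta)}\otimes x^\mu)=q^{-|\beta|}(-q)^{-\sum_{s<i}\mu_s}x^{(\beta)}\otimes x^{\mu-\epsilon_i}$ for $i\notin I_0$ (zero if an exponent becomes negative). **The modules $V(\lambda)$.** For $\lambda\in\mathbb Z^{m+n}$ let $M(\lambda)$ be the Verma module over $\mathcal U_q$ (resp. $u_q$), i.e. the quotient of the algebra by the left ideal generated by all $E_j$,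 all $K_\gamma-q^{(\lambda,\gamma)}$, and $\sigma-(-1)^{\sum_{i>m}\lambda_i}$, and let $V(\lambda)$ be the quotient of $M(\lambda)$ by its largest submodule contained in $\sum_jF_jM(\lambda)$ (the highest weight module of highest weight $\lambda$). **Claim.** (i) If $\mathbf{char}(q)=0$, then $V(t\omega_1)$ is simple, $\Omega_q(m|n)^{(t)}$ is a submodule of $\Omega_q(m|n)$ isomorphic to $V(t\omega_1)$, and $$\dim\Omega_q(m|n)^{(t)}=\dim V(t\omega_1)=\sum_{0\le s\le \min(t,n)}\binom{m+t-s-1}{t-s}\binom ns .$$ (ii) Let $\mathbf{char}(q)=\ell\ge3$ and $N=m(\ell-1)$. Then $$\dim\Omega_q(m|n,\mathbf 1)^{(t)}=\sum_{0\le s\le\min(t,n)}\binom ns\dim\mathcal A_q(m,\mathbf 1)^{(t-s)},$$ where, for all $s\ge 0$, $$\dim\mathcal A_q(m,\mathbf 1)^{(s)}=\sum_{i=0}^{\lfloor s/\ell\rfloor}(-1)^i\binom mi\binom{m+s-i\ell-1}{m-1}.$$ Moreover $\Omega_q(m|n,\mathbf 1)^{(t)}$ is a submodule of $\Omega_q(m|n,\mathbf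 1)$ isomorphic to $V(\lambda)$, which is simple, and hence $\dim\Omega_q(m|n,\mathbf 1)^{(t)}=\dim V(\lambda)$, where $\lambda=(\ell-1-t_i)\omega_{i-1}+t_i\omega_i$ if $t=(i-1)(\ell-1)+t_i$ with $1\le i\le m$, $0\le t_i\le\ell-1$, and $\lambda=(\ell-2)\omega_m+\omega_{m+p}$ if $t=N+p$ with $0\le p\le n$. -/

import Mathlib

namespace QGrassmann
open scoped TensorProduct
variable {k : Type*} [Field k]

/-- The `q`-integer `[n] = q^(n-1) + q^(n-3) + ... + q^(1-n)`, i.e. the Laurent polynomial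
`(v^n - v^(-n)) / (v - v^(-1))` evaluated at `v = q`. -/
def qInt (q : k) (n : ℕ) : k := ∑ i ∈ Finset.range n, q ^ ((n : ℤ) - 1 - 2 * i)

/-- The `q`-factorial `[n]! = [1][2]...[n]`. -/
def qFactorial (q : k) (n : ℕ) : k := ∏ i ∈ Finset.range n, qInt q (i + 1)

/-- The `q`-binomial coefficient: the Laurent polynomial `[n]! / ([r]! [n-r]!)` evaluated at `v = q`
(so it makes sense at roots of unity), computed by the Pascal rule
`[n, r] = q^(r-n) [n-1, r-1] + q^r [n-1, r]`. -/
def qBinom (q : k) : ℕ → ℕ → k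
  | _, 0 => 1
  | 0, _ + 1 => 0
  | n + 1, r + 1 => q ^ ((r : ℤ) - n) * qBinom q n r + q ^ (r + 1) * qBinom q n (r + 1)

/-- The characteristic of `q`: the least `ℓ ≥ 1` with `[ℓ] = 0`, and `0` if there is none. -/
noncomputable def qChar (q : k) : ℕ := sInf {l : ℕ | 1 ≤ l ∧ qInt q l = 0}

theorem qInt_add (q : k) (hq : q ≠ 0) (a b : ℕ) :
    qInt q (a + b) = q ^ (-(b : ℤ)) * qInt q a + q ^ (a : ℤ) * qInt q b := by
  unfold qInt
  rw [add_comm a b, Finset.sum_range_add, add_comm, Finset.mul_sum, Finset.mul_sum]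
  congr 1
  · apply Finset.sum_congr rfl; intro i _
    rw [← zpow_add₀ hq]; congr 1; push_cast; ring
  · apply Finset.sum_congr rfl; intro i _
    rw [← zpow_add₀ hq]; congr 1; push_cast; ring

theorem qBinom_of_lt (q : k) (n r : ℕ) (h : n < r) : qBinom q n r = 0 := by
  induction n generalizing r with
  | zero => cases r with
    | zero => omega
    | succ r => rfl
  | succ n ih => cases r with
    | zero => omega
    | succ r => rw [qBinom, ih r (by omega), ih (r+1) (by omega)]; simp

/-- The defining property of the `q`-binomial coefficients. -/
theorem qBinom_mul (q : k) (hq : q ≠ 0) (a b : ℕ) :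
    qBinom q (a + b) a * (qFactorial q a * qFactorial q b) = qFactorial q (a + b) := by
  induction h : a + b generalizing a b with
  | zero =>
    obtain rfl : a = 0 := by omega
    obtain rfl : b = 0 := by omega
    simp [qBinom, qFactorial]
  | succ c ih =>
    cases a with
    | zero =>
      obtain rfl : b = c + 1 := by omega
      simp [qBinom, qFactorial]
    | succ a =>
      have e1 := ih a b (by omega)
      have fs : ∀ n, qFactorial q (n + 1) = qFactorial q n * qInt q (n + 1) :=
        fun n => Finset.prod_range_succ _ _
      cases b with
      | zero =>
        obtain rfl : a = c := by omega
        rw [qBinom, qBinom_of_lt q a (a+1) (by omega), fs]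
        have h5 : qFactorial q 0 = 1 := by simp [qFactorial]
        rw [h5, mul_one] at e1 ⊢
        rw [sub_self, zpow_zero, one_mul, mul_zero, add_zero, ← mul_assoc, e1]
      | succ b =>
        have e2 := ih (a + 1) b (by omega)
        obtain rfl : c = a + 1 + b := by omega
        rw [qBinom, fs (a + 1 + b)]
        have := qInt_add q hq (a + 1) (b + 1)
        rw [show a + 1 + b + 1 = a + 1 + (b + 1) by ring, this, mul_add, ← mul_assoc]
        nth_rewrite 1 [← e1]
        rw [← mul_assoc, ← e2, fs a, fs b]
        have h3 : q ^ ((a : ℤ) - ((a + 1 + b : ℕ) : ℤ)) = q ^ (-((b + 1 : ℕ) : ℤ)) := by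
          congr 1; push_cast; ring
        have h4 : q ^ (((a + 1 : ℕ)) : ℤ) = q ^ (a + 1) := zpow_natCast _ _
        rw [h3, h4]
        ring

/-- The relations `x_i^2 = 0`, `x_j x_i + p^(-1) x_i x_j = 0` (`i < j`). -/
inductive ExtRel (p : k) (n : ℕ) : FreeAlgebra k (Fin n) → FreeAlgebra k (Fin n) → Prop
  | sq (i : Fin n) : ExtRel p n (FreeAlgebra.ι k i * FreeAlgebra.ι k i) 0
  | anti (i j : Fin n) (h : i < j) :
      ExtRel p n (FreeAlgebra.ι k j * FreeAlgebra.ι k i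
        + p⁻¹ • (FreeAlgebra.ι k i * FreeAlgebra.ι k j)) 0

/-- The quantum exterior algebra `Λ_p(n)`, a quotient of the free algebra. Its generators are
numbered by `Fin n`; in the superalgebra below they are the last `n` of `m + n` variables. -/
def QExterior (p : k) (n : ℕ) : Type _ := RingQuot (ExtRel p n)

noncomputable instance (p : k) (n : ℕ) : Ring (QExterior p n) :=
  inferInstanceAs (Ring (RingQuot (ExtRel p n)))

noncomputable instance (p : k) (n : ℕ) : Algebra k (QExterior p n) :=
  inferInstanceAs (Algebra k (RingQuot (ExtRel p n)))

/-- The quotient map from the free algebra. -/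
noncomputable def extMk (p : k) (n : ℕ) : FreeAlgebra k (Fin n) →ₐ[k] QExterior p n :=
  RingQuot.mkAlgHom k (ExtRel p n)

/-- The generators of `Λ_p(n)`. -/
noncomputable def extGen (p : k) {n : ℕ} (i : Fin n) : QExterior p n :=
  extMk p n (FreeAlgebra.ι k i)

theorem extMk_rel (p : k) {n : ℕ} {a b : FreeAlgebra k (Fin n)} (h : ExtRel p n a b) :
    extMk p n a = extMk p n b :=
  RingQuot.mkAlgHom_rel k h

theorem extMk_surjective (p : k) (n : ℕ) : Function.Surjective (extMk p n) :=
  RingQuot.mkAlgHom_surjective k (ExtRel p n)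

/-- The monomial `x^μ = x_{i_1} ... x_{i_s}` for `μ = {i_1 < ... < i_s}`. -/
noncomputable def extMonomial (p : k) {n : ℕ} (μ : Finset (Fin n)) : QExterior p n :=
  ((μ.sort (· ≤ ·)).map (extGen p)).prod

theorem extGen_sq (p : k) {n : ℕ} (i : Fin n) : extGen p i * extGen p i = 0 := by
  have := extMk_rel p (ExtRel.sq (p := p) i)
  simpa [extGen] using this

theorem extGen_anti (p : k) {n : ℕ} {i j : Fin n} (h : i < j) :
    extGen p j * extGen p i = -(p⁻¹ • (extGen p i * extGen p j)) := by
  have := extMk_rel p (ExtRel.anti (p := p) i j h)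
  rw [eq_neg_iff_add_eq_zero]
  simpa [extGen] using this

/-- Left multiplication by a generator, in the monomials (used to prove them independent). -/
noncomputable def extShift (p : k) {n : ℕ} (i : Fin n) :
    Module.End k (Finset (Fin n) →₀ k) :=
  Finsupp.lsum k fun μ => if i ∈ μ then 0 else
    (-p⁻¹) ^ (μ.filter (· < i)).card • Finsupp.lsingle (insert i μ)

theorem extShift_single (p : k) {n : ℕ} (i : Fin n) (μ : Finset (Fin n)) (c : k) :
    extShift p i (Finsupp.single μ c) = if i ∈ μ then 0 else
      (-p⁻¹) ^ (μ.filter (· < i)).card • Finsupp.single (insert i μ) c := by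
  unfold extShift
  rw [Finsupp.lsum_single]
  split_ifs <;> simp

theorem extShift_rel (p : k) {n : ℕ} (a b : FreeAlgebra k (Fin n)) (h : ExtRel p n a b) :
    FreeAlgebra.lift k (extShift p) a = FreeAlgebra.lift k (extShift p) b := by
  cases h with
  | sq i =>
    rw [map_mul, map_zero, FreeAlgebra.lift_ι_apply]
    ext μ : 1
    ext1
    simp only [LinearMap.coe_comp, Function.comp, Finsupp.lsingle_apply, Module.End.mul_apply,
      extShift_single, LinearMap.zero_apply]
    split_ifs <;> simp [extShift_single]
  | anti i j hij =>
    rw [map_add, map_smul, map_mul, map_mul, map_zero, FreeAlgebra.lift_ι_apply,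
      FreeAlgebra.lift_ι_apply]
    ext μ : 1
    ext1
    simp only [LinearMap.coe_comp, Function.comp, Finsupp.lsingle_apply, Module.End.mul_apply,
      extShift_single, LinearMap.zero_apply, LinearMap.add_apply, LinearMap.smul_apply]
    have hne : j ≠ i := hij.ne'
    by_cases hi : i ∈ μ
    · by_cases hj : j ∈ μ <;> simp [hi, hj, extShift_single]
    · by_cases hj : j ∈ μ
      · simp [hi, hj, extShift_single]
      · have h1 : (insert i μ).filter (· < j) = insert i (μ.filter (· < j)) := by
          rw [Finset.filter_insert, if_pos hij]
        have h2 : (insert j μ).filter (· < i) = μ.filter (· < i) := by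
          rw [Finset.filter_insert, if_neg hij.not_gt]
        have h3 : i ∉ μ.filter (· < j) := fun h => hi (Finset.mem_filter.1 h).1
        simp only [hi, hj, if_false, map_smul, extShift_single, Finset.mem_insert, hne, hne.symm,
          or_self, h1, h2, Finset.card_insert_of_notMem h3, Finset.insert_comm j i, smul_smul,
          ← add_smul]
        rw [pow_succ]
        convert zero_smul k _ using 2
        ring

/-- The left regular representation, in the monomials. -/
noncomputable def extRep (p : k) (n : ℕ) :
    QExterior p n →ₐ[k] Module.End k (Finset (Fin n) →₀ k) :=
  RingQuot.liftAlgHom k ⟨FreeAlgebra.lift k (extShift p), extShift_rel p⟩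

theorem extRep_monomial (p : k) {n : ℕ} (μ : Finset (Fin n)) :
    extRep p n (extMonomial p μ) (Finsupp.single ∅ 1) = Finsupp.single μ 1 := by
  have key : ∀ l : List (Fin n), l.Pairwise (· < ·) →
      extRep p n ((l.map (extGen p)).prod) (Finsupp.single ∅ 1)
        = Finsupp.single l.toFinset 1 := by
    intro l
    induction l with
    | nil => intro _; simp
    | cons a l ih =>
      intro h
      rw [List.pairwise_cons] at h
      have hg : extRep p n (extGen p a) = extShift p a := by
        exact (RingQuot.liftAlgHom_mkAlgHom_apply k _ (extShift_rel p) _).trans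
          (FreeAlgebra.lift_ι_apply _ _)
      have h1 : a ∉ l.toFinset := by
        intro h'; exact lt_irrefl _ (h.1 a (List.mem_toFinset.1 h'))
      have h2 : l.toFinset.filter (· < a) = ∅ := by
        rw [Finset.filter_eq_empty_iff]
        intro b hb; exact (h.1 b (List.mem_toFinset.1 hb)).not_gt
      rw [List.map_cons, List.prod_cons, map_mul, Module.End.mul_apply, ih h.2, hg,
        extShift_single, if_neg h1, h2]
      simp
  have := key (μ.sort (· ≤ ·)) (Finset.sortedLT_sort μ).pairwise
  rwa [Finset.sort_toFinset] at this

theorem extMonomial_linearIndependent (p : k) (n : ℕ) :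
    LinearIndependent k (extMonomial p : Finset (Fin n) → QExterior p n) := by
  let f : QExterior p n →ₗ[k] (Finset (Fin n) →₀ k) :=
    (LinearMap.applyₗ (Finsupp.single ∅ 1)).comp (extRep p n).toLinearMap
  apply LinearIndependent.of_comp f
  have : f ∘ extMonomial p = fun μ => Finsupp.single μ (1 : k) := by
    funext μ; exact extRep_monomial p μ
  rw [this]
  exact (Finsupp.basisSingleOne (R := k) (ι := Finset (Fin n))).linearIndependent

theorem extMonomial_of_list (p : k) {n : ℕ} (l : List (Fin n)) (h : l.Pairwise (· < ·)) :
    (l.map (extGen p)).prod = extMonomial p l.toFinset := by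
  unfold extMonomial
  rw [(List.toFinset_sort (· ≤ ·) (h.imp (fun h => h.ne))).2 (h.imp (fun h => h.le))]

theorem extGen_mul_mem (p : k) {n : ℕ} (i : Fin n) (l : List (Fin n)) (h : l.Pairwise (· < ·)) :
    ∃ (c : k) (l' : List (Fin n)), l'.Pairwise (· < ·) ∧ (∀ x ∈ l', x = i ∨ x ∈ l) ∧
      extGen p i * (l.map (extGen p)).prod = c • (l'.map (extGen p)).prod := by
  induction l with
  | nil => exact ⟨1, [i], by simp, by simp, by simp⟩
  | cons a l ih =>
    have h' := h
    rw [List.pairwise_cons] at h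
    rcases lt_trichotomy i a with hia | rfl | hia
    · refine ⟨1, i :: a :: l, ?_, by simp, by simp⟩
      rw [List.pairwise_cons]
      refine ⟨?_, h'⟩
      intro b hb
      rcases List.mem_cons.1 hb with rfl | hb
      · exact hia
      · exact hia.trans (h.1 b hb)
    · refine ⟨0, [], by simp, by simp, ?_⟩
      rw [List.map_cons, List.prod_cons, ← mul_assoc, extGen_sq]; simp
    · obtain ⟨c, l', h1, h2, h3⟩ := ih h.2
      refine ⟨-p⁻¹ * c, a :: l', ?_, ?_, ?_⟩
      · rw [List.pairwise_cons]
        refine ⟨?_, h1⟩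
        intro b hb
        rcases h2 b hb with rfl | hb
        · exact hia
        · exact h.1 b hb
      · intro x hx
        rcases List.mem_cons.1 hx with rfl | hx
        · simp
        · rcases h2 x hx with h | h <;> simp [h]
      · rw [List.map_cons, List.prod_cons, ← mul_assoc, extGen_anti p hia, List.map_cons,
          List.prod_cons, neg_mul, smul_mul_assoc, mul_assoc, h3, mul_smul_comm, smul_smul,
          neg_mul, neg_smul]

theorem extMonomial_span (p : k) (n : ℕ) :
    ⊤ ≤ Submodule.span k (Set.range (extMonomial p : Finset (Fin n) → QExterior p n)) := by
  set S := Submodule.span k (Set.range (extMonomial p : Finset (Fin n) → QExterior p n))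
  have hgen : ∀ i : Fin n, ∀ w ∈ S, extGen p i * w ∈ S := by
    intro i w hw
    induction hw using Submodule.span_induction with
    | mem w hw =>
      obtain ⟨μ, rfl⟩ := hw
      obtain ⟨c, l', h1, -, h3⟩ := extGen_mul_mem p i _ (Finset.sortedLT_sort μ).pairwise
      rw [extMonomial, h3, extMonomial_of_list p l' h1]
      exact S.smul_mem _ (Submodule.subset_span ⟨_, rfl⟩)
    | zero => simp
    | add x y _ _ hx hy => rw [mul_add]; exact S.add_mem hx hy
    | smul c x _ hx => rw [mul_smul_comm]; exact S.smul_mem _ hx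
  have hall : ∀ a : FreeAlgebra k (Fin n), ∀ w ∈ S,
      extMk p n a * w ∈ S := by
    intro a
    induction a using FreeAlgebra.induction with
    | grade0 r => intro w hw; rw [AlgHom.commutes, ← Algebra.smul_def]; exact S.smul_mem _ hw
    | grade1 i => exact hgen i
    | mul a b ha hb => intro w hw; rw [map_mul, mul_assoc]; exact ha _ (hb _ hw)
    | add a b ha hb => intro w hw; rw [map_add, add_mul]; exact S.add_mem (ha _ hw) (hb _ hw)
  intro w _
  obtain ⟨a, rfl⟩ := extMk_surjective p n w
  have h1 : (1 : QExterior p n) ∈ S := Submodule.subset_span ⟨∅, by simp [extMonomial]⟩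
  simpa using hall a 1 h1

/-- The monomial basis `x^μ` of `Λ_p(n)`. -/
noncomputable def extBasis (p : k) (n : ℕ) : Module.Basis (Finset (Fin n)) k (QExterior p n) :=
  Module.Basis.mk (extMonomial_linearIndependent p n) (extMonomial_span p n)

/-! The quantum (restricted) divided power algebra. -/

/-- The quantum divided power algebra `A_q(m)`, the vector space with basis `x^(β)`, `β ∈ ℕ^m`;
its product is `divPowMul`. -/
abbrev DivPow (k : Type*) [Field k] (m : ℕ) : Type _ := (Fin m → ℕ) →₀ k

/-- The basis `x^(β)` of `A_q(m)`. -/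
noncomputable def divPowBasis (k : Type*) [Field k] (m : ℕ) :
    Module.Basis (Fin m → ℕ) k (DivPow k m) :=
  Finsupp.basisSingleOne

/-- `β * γ = ∑_{i > j} β_i γ_j`. -/
def starProd {m : ℕ} (β γ : Fin m → ℕ) : ℕ := ∑ i, ∑ j ∈ Finset.Iio i, β i * γ j

/-- The product `x^(β) x^(γ) = q^(β * γ) [β + γ, β] x^(β + γ)` of `A_q(m)`. -/
noncomputable def divPowMul (q : k) (m : ℕ) : DivPow k m →ₗ[k] DivPow k m →ₗ[k] DivPow k m :=
  (divPowBasis k m).constr k fun β => (divPowBasis k m).constr k fun γ =>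
    (q ^ starProd β γ * ∏ i, qBinom q (β i + γ i) (β i)) • divPowBasis k m (β + γ)

/-- The homogeneous component `A_q(m)^(t)`. -/
noncomputable def divPowDeg (k : Type*) [Field k] (m t : ℕ) : Submodule k (DivPow k m) :=
  Submodule.span k {w | ∃ β : Fin m → ℕ, ∑ i, β i = t ∧ w = divPowBasis k m β}

/-- The homogeneous component `A_q(m, 1)^(t)` of the quantum restricted divided power algebra,
which is spanned by the `x^(β)` with all `β_i ≤ ℓ - 1`. -/
noncomputable def restrictedDivPowDeg (k : Type*) [Field k] (ℓ m t : ℕ) :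
    Submodule k (DivPow k m) :=
  Submodule.span k
    {w | ∃ β : Fin m → ℕ, (∀ i, β i ≤ ℓ - 1) ∧ ∑ i, β i = t ∧ w = divPowBasis k m β}

/-- The homogeneous component `Λ_p(n)^(j)`. -/
noncomputable def extDeg (p : k) (n j : ℕ) : Submodule k (QExterior p n) :=
  Submodule.span k {w | ∃ μ : Finset (Fin n), μ.card = j ∧ w = extMonomial p μ}

/-! The quantum Grassmann superalgebra. -/

/-- The quantum Grassmann superalgebra `Ω_q(m|n) = A_q(m) ⊗ Λ_{q⁻¹}(n)`; its product is
`omegaMul`. -/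
abbrev Omega (q : k) (m n : ℕ) : Type _ := DivPow k m ⊗[k] QExterior q⁻¹ n

/-- The monomial basis `x^(β) ⊗ x^μ` of `Ω_q(m|n)`. -/
noncomputable def omegaBasis (q : k) (m n : ℕ) :
    Module.Basis ((Fin m → ℕ) × Finset (Fin n)) k (Omega q m n) :=
  (divPowBasis k m).tensorProduct (extBasis q⁻¹ n)

/-- The product `(x^(α) ⊗ x^μ) (x^(β) ⊗ x^ν) = q^(|μ||β|) x^(α) x^(β) ⊗ x^μ x^ν`. -/
noncomputable def omegaMul (q : k) (m n : ℕ) :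
    Omega q m n →ₗ[k] Omega q m n →ₗ[k] Omega q m n :=
  (omegaBasis q m n).constr k fun a => (omegaBasis q m n).constr k fun b =>
    q ^ (a.2.card * ∑ i, b.1 i) •
      (divPowMul q m (divPowBasis k m a.1) (divPowBasis k m b.1) ⊗ₜ[k]
        (extMonomial q⁻¹ a.2 * extMonomial q⁻¹ b.2))

/-- `Ω_q(m|n)^(t) = ⨁_{i+j=t} A_q(m)^(i) ⊗ Λ_{q⁻¹}(n)^(j)`. -/
noncomputable def omegaDeg (q : k) (m n t : ℕ) : Submodule k (Omega q m n) :=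
  ⨆ p ∈ Finset.HasAntidiagonal.antidiagonal t,
    Submodule.map₂ (TensorProduct.mk k (DivPow k m) (QExterior q⁻¹ n))
      (divPowDeg k m p.1) (extDeg q⁻¹ n p.2)

/-- `Ω_q(m|n, 1)^(t) = ⨁_{i+j=t} A_q(m, 1)^(i) ⊗ Λ_{q⁻¹}(n)^(j)`, inside `Ω_q(m|n)`. -/
noncomputable def restrictedOmegaDeg (q : k) (ℓ m n t : ℕ) : Submodule k (Omega q m n) :=
  ⨆ p ∈ Finset.HasAntidiagonal.antidiagonal t,
    Submodule.map₂ (TensorProduct.mk k (DivPow k m) (QExterior q⁻¹ n))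
      (restrictedDivPowDeg k ℓ m p.1) (extDeg q⁻¹ n p.2)

/-! Quantum differential operators on `Ω_q(m|n)`. The indices `1, ..., m + n` are `Fin (m + n)`;
the first `m` are even, the last `n` odd. -/

/-- The variable `x_i`: `x^(ε_i) ⊗ 1` for `i` even, `1 ⊗ x_i` for `i` odd. -/
noncomputable def omegaVar (q : k) {m n : ℕ} (i : Fin (m + n)) : Omega q m n :=
  Fin.addCases (fun a => omegaBasis q m n (Pi.single a 1, ∅))
    (fun b => omegaBasis q m n (0, {b})) i

/-- The exponent of `x_i` in a monomial, i.e. the weight of the monomial, in `ℤ^(m+n)`. -/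
def monomialWeight {m n : ℕ} (a : (Fin m → ℕ) × Finset (Fin n)) : Fin (m + n) → ℤ :=
  Fin.append (fun i => (a.1 i : ℤ)) (fun j => if j ∈ a.2 then 1 else 0)

/-- The operator acting on each monomial by a scalar. -/
noncomputable def diagOp (q : k) {m n : ℕ} (c : (Fin m → ℕ) × Finset (Fin n) → k) :
    Module.End k (Omega q m n) :=
  (omegaBasis q m n).constr k fun a => c a • omegaBasis q m n a

/-- The eigenvalue of `σ_i` on a monomial: `q^(β_i)` for `i` even, `(-q)^(μ_i)` for `i` odd. -/
def sigmaEigenvalue (q : k) {m n : ℕ} (i : Fin (m + n)) (a : (Fin m → ℕ) × Finset (Fin n)) : k :=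
  (if i.val < m then q else -q) ^ monomialWeight a i

/-- The `q`-derivative `∂_i`: for `i` even
`∂_i (x^(β) ⊗ x^μ) = q^(-(β_1 + ... + β_{i-1})) x^(β - ε_i) ⊗ x^μ`, and for `i` odd
`∂_i (x^(β) ⊗ x^μ) = q^(-|β|) (-q)^(-#{j ∈ μ | j < i}) x^(β) ⊗ x^(μ - ε_i)`; monomials with a
negative exponent are zero. -/
noncomputable def qDeriv (q : k) {m n : ℕ} (i : Fin (m + n)) : Module.End k (Omega q m n) :=
  (omegaBasis q m n).constr k fun a =>
    Fin.addCases
      (fun s => if a.1 s = 0 then 0 else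
        q ^ (-((∑ j ∈ Finset.Iio s, a.1 j : ℕ) : ℤ)) •
          omegaBasis q m n (a.1 - Pi.single s 1, a.2))
      (fun s => if s ∉ a.2 then 0 else
        (q ^ (-((∑ j, a.1 j : ℕ) : ℤ)) * (-q) ^ (-((a.2.filter (· < s)).card : ℤ))) •
          omegaBasis q m n (a.1, a.2.erase s))
      i

/-! Weights. -/

/-- The lower index `j` of the simple root with number `j`. -/
def lowIdx {m n : ℕ} (j : Fin (m + n - 1)) : Fin (m + n) := ⟨j.val, by omega⟩

/-- The upper index `j + 1` of the simple root with number `j`. -/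
def highIdx {m n : ℕ} (j : Fin (m + n - 1)) : Fin (m + n) := ⟨j.val + 1, by omega⟩

/-- The simple root `α_j = ε_j - ε_{j+1}`. -/
def simpleRoot {m n : ℕ} (j : Fin (m + n - 1)) : Fin (m + n) → ℤ :=
  Pi.single (lowIdx j) 1 - Pi.single (highIdx j) 1

/-- The fundamental weight `ω_i = ε_1 + ... + ε_i` (with `i` counted from `1`, and `ω_0 = 0`). -/
def fundWeight (m n i : ℕ) : Fin (m + n) → ℤ := fun j => if j.val < i then 1 else 0

/-- The form `(ε_i, ε_j) = ± δ_ij`, with sign `+` for `i` even and `-` for `i` odd. -/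
def weightForm {m n : ℕ} (a b : Fin (m + n) → ℤ) : ℤ :=
  ∑ i, (if i.val < m then 1 else -1) * a i * b i

/-- The parity `∑_{i odd} λ_i` of a weight. -/
def oddDegree {m n : ℕ} (a : Fin (m + n) → ℤ) : ℤ := ∑ i, if i.val < m then 0 else a i

/-- The two series of Lie superalgebras, `gl(m|n)` and `sl(m|n)`. -/
inductive Series
  | gl
  | sl

/-- The lattice that indexes the group-like elements `K_γ`: all of `ℤ^(m+n)` for `gl(m|n)`, with
`K_i = K_{ε_i}`; the root lattice for `sl(m|n)`, with `K_{α_j} = K_j K_{j+1}^{-1}`. -/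
def torusLattice (m n : ℕ) : Series → AddSubgroup (Fin (m + n) → ℤ)
  | .gl => ⊤
  | .sl => AddSubgroup.closure (Set.range simpleRoot)

theorem simpleRoot_mem {m n : ℕ} (g : Series) (j : Fin (m + n - 1)) :
    simpleRoot j ∈ torusLattice m n g := by
  cases g
  · exact AddSubgroup.mem_top _
  · exact AddSubgroup.subset_closure ⟨j, rfl⟩

/-- The simple root as an element of the lattice. -/
def rootElt {m n : ℕ} (g : Series) (j : Fin (m + n - 1)) : torusLattice m n g :=
  ⟨simpleRoot j, simpleRoot_mem g j⟩

/-! The quantum superalgebras `U_q(gl(m|n))`, `U_q(sl(m|n))`, their bosonizations, and the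
restricted versions. -/

/-- The generators `E_j`, `F_j`, `K_γ` and the parity element `σ`. -/
inductive Gen (m n : ℕ) (g : Series)
  | E (j : Fin (m + n - 1))
  | F (j : Fin (m + n - 1))
  | K (γ : torusLattice m n g)
  | sigma

section Relations

variable (k) {m n : ℕ} {g : Series}

/-- `E_j` in the free algebra. -/
def fE (j : Fin (m + n - 1)) : FreeAlgebra k (Gen m n g) := FreeAlgebra.ι k (.E j)
/-- `F_j` in the free algebra. -/
def fF (j : Fin (m + n - 1)) : FreeAlgebra k (Gen m n g) := FreeAlgebra.ι k (.F j)
/-- `K_γ` in the free algebra. -/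
def fK (γ : torusLattice m n g) : FreeAlgebra k (Gen m n g) := FreeAlgebra.ι k (.K γ)
/-- `σ` in the free algebra. -/
def fSigma : FreeAlgebra k (Gen m n g) := FreeAlgebra.ι k .sigma

variable {k}

/-- The sign `(-1)^p(E_j)`: `-1` for the odd simple root `α_m`, and `1` otherwise. -/
def parSign (k : Type*) [Field k] {m n : ℕ} (j : Fin (m + n - 1)) : k :=
  if j.val + 1 = m then -1 else 1

/-- `q_j`: `q` for `j ≤ m`, and `q⁻¹` for `j > m`. -/
def qIdx (q : k) {m n : ℕ} (j : Fin (m + n - 1)) : k := if j.val < m then q else q⁻¹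

/-- The quantum Serre relator `X^2 Y - (q + q⁻¹) X Y X + Y X^2`. -/
def serre {A : Type*} [Ring A] [Algebra k A] (q : k) (X Y : A) : A :=
  X ^ 2 * Y - (q + q⁻¹) • (X * Y * X) + Y * X ^ 2

/-- The higher order relator of `X = E_{m-1}`, `Y = E_m`, `Z = E_{m+1}`. -/
def superSerre {A : Type*} [Ring A] [Algebra k A] (q : k) (X Y Z : A) : A :=
  X * Y * Z * Y + Y * X * Y * Z + Z * Y * X * Y + Y * Z * Y * X - (q + q⁻¹) • (Y * X * Z * Y)

/-- The defining relations of the bosonization of `U_q(gl(m|n))` or `U_q(sl(m|n))`. The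
constructors `smash_*` are the relations `σ^2 = 1`, `σ x σ = σ(x)` of the smash product with
`k[ℤ_2]`. -/
inductive QRel (q : k) (m n : ℕ) (g : Series) :
    FreeAlgebra k (Gen m n g) → FreeAlgebra k (Gen m n g) → Prop
  | K_zero : QRel q m n g (fK k 0) 1
  | K_add (γ δ) : QRel q m n g (fK k (γ + δ)) (fK k γ * fK k δ)
  | K_E (γ) (j) : QRel q m n g (fK k γ * fE k j)
      (q ^ weightForm γ.1 (simpleRoot j) • (fE k j * fK k γ))
  | K_F (γ) (j) : QRel q m n g (fK k γ * fF k j)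
      (q ^ (-weightForm γ.1 (simpleRoot j)) • (fF k j * fK k γ))
  | E_F_same (j) : QRel q m n g (fE k j * fF k j - parSign k j • (fF k j * fE k j))
      ((qIdx q j - (qIdx q j)⁻¹)⁻¹ • (fK k (rootElt g j) - fK k (-rootElt g j)))
  | E_F_ne (i j) (h : i ≠ j) : QRel q m n g (fE k i * fF k j) (fF k j * fE k i)
  | E_comm (i j) (h : i.val + 1 < j.val) : QRel q m n g (fE k i * fE k j) (fE k j * fE k i)
  | F_comm (i j) (h : i.val + 1 < j.val) : QRel q m n g (fF k i * fF k j) (fF k j * fF k i)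
  | E_serre (i j) (h : i.val + 1 = j.val ∨ j.val + 1 = i.val) (hi : i.val + 1 ≠ m) :
      QRel q m n g (serre q (fE k i) (fE k j)) 0
  | F_serre (i j) (h : i.val + 1 = j.val ∨ j.val + 1 = i.val) (hi : i.val + 1 ≠ m) :
      QRel q m n g (serre q (fF k i) (fF k j)) 0
  | E_odd (j) (h : j.val + 1 = m) : QRel q m n g (fE k j ^ 2) 0
  | F_odd (j) (h : j.val + 1 = m) : QRel q m n g (fF k j ^ 2) 0
  | E_super (a b c) (hab : a.val + 1 = b.val) (hb : b.val + 1 = m) (hbc : b.val + 1 = c.val) :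
      QRel q m n g (superSerre q (fE k a) (fE k b) (fE k c)) 0
  | F_super (a b c) (hab : a.val + 1 = b.val) (hb : b.val + 1 = m) (hbc : b.val + 1 = c.val) :
      QRel q m n g (superSerre q (fF k a) (fF k b) (fF k c)) 0
  | smash_sq : QRel q m n g (fSigma k * fSigma k) 1
  | smash_K (γ) : QRel q m n g (fSigma k * fK k γ * fSigma k) (fK k γ)
  | smash_E (j) : QRel q m n g (fSigma k * fE k j * fSigma k) (parSign k j • fE k j)
  | smash_F (j) : QRel q m n g (fSigma k * fF k j * fSigma k) (parSign k j • fF k j)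

/-- The relations of the restricted quantum algebra: in addition `E_j^ℓ = F_j^ℓ = 0` for `j ≠ m`
and `K_γ^(2ℓ) = 1`. -/
inductive RestrictedQRel (q : k) (ℓ m n : ℕ) (g : Series) :
    FreeAlgebra k (Gen m n g) → FreeAlgebra k (Gen m n g) → Prop
  | base {a b} (h : QRel q m n g a b) : RestrictedQRel q ℓ m n g a b
  | E_pow (j) (h : j.val + 1 ≠ m) : RestrictedQRel q ℓ m n g (fE k j ^ ℓ) 0
  | F_pow (j) (h : j.val + 1 ≠ m) : RestrictedQRel q ℓ m n g (fF k j ^ ℓ) 0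
  | K_pow (γ) : RestrictedQRel q ℓ m n g (fK k γ ^ (2 * ℓ)) 1

end Relations

/-- The algebra with the given generators and a set `R` of relations: for `R = QRel q m n g` the
bosonization `𝒰_q`, for `R = RestrictedQRel q ℓ m n g` the restricted algebra `u_q`. -/
def QAlg {m n : ℕ} {g : Series}
    (R : FreeAlgebra k (Gen m n g) → FreeAlgebra k (Gen m n g) → Prop) : Type _ := RingQuot R

section HighestWeight

variable {m n : ℕ} {g : Series} (R : FreeAlgebra k (Gen m n g) → FreeAlgebra k (Gen m n g) → Prop)

noncomputable instance : Ring (QAlg R) := inferInstanceAs (Ring (RingQuot R))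

noncomputable instance : Algebra k (QAlg R) := inferInstanceAs (Algebra k (RingQuot R))

/-- The image of a generator. -/
noncomputable def QAlg.gen (x : Gen m n g) : QAlg R := RingQuot.mkAlgHom k R (FreeAlgebra.ι k x)

/-- The left ideal generated by all `E_j`, all `K_γ - q^(λ, γ)`, and `σ - (-1)^(parity of λ)`. -/
noncomputable def vermaIdeal (q : k) (wt : Fin (m + n) → ℤ) : Submodule (QAlg R) (QAlg R) :=
  Submodule.span (QAlg R)
    ({x | ∃ j, x = QAlg.gen R (.E j)} ∪
      {x | ∃ γ : torusLattice m n g,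
        x = QAlg.gen R (.K γ) - algebraMap k (QAlg R) (q ^ weightForm wt γ.1)} ∪
      {QAlg.gen R .sigma - algebraMap k (QAlg R) ((-1) ^ oddDegree wt)})

/-- The Verma module `M(λ)`, the universal module generated by a highest weight vector of weight
`λ`. -/
abbrev Verma (q : k) (wt : Fin (m + n) → ℤ) : Type _ := QAlg R ⧸ vermaIdeal R q wt

/-- The subspace `∑_j F_j M(λ)` of `M(λ)`. It is the sum of the components of weight lower than
`λ`. -/
noncomputable def vermaLower (q : k) (wt : Fin (m + n) → ℤ) : Submodule k (Verma R q wt) :=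
  Submodule.span k {x | ∃ (j : Fin (m + n - 1)) (y : Verma R q wt), x = QAlg.gen R (.F j) • y}

/-- The largest submodule of `M(λ)` without component of weight `λ`, i.e. the sum of all submodules
contained in `∑_j F_j M(λ)`. It is the largest proper weight-graded submodule of `M(λ)`, and
the largest proper submodule for `gl(m|n)` and generic `q`. -/
noncomputable def vermaRadical (q : k) (wt : Fin (m + n) → ℤ) :
    Submodule (QAlg R) (Verma R q wt) :=
  sSup {P | ∀ x ∈ P, x ∈ vermaLower R q wt}

/-- The simple highest weight module `V(λ)`. -/
abbrev SimpleHW (q : k) (wt : Fin (m + n) → ℤ) : Type _ := Verma R q wt ⧸ vermaRadical R q wt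

end HighestWeight

/-! The action on `Ω_q(m|n)`. -/

/-- The action of the generators on `Ω_q(m|n)`:
`E_j = x_j ∂_{j+1} σ_j`, `F_j = σ_j^{-1} x_{j+1} ∂_j`; `K_γ` multiplies a monomial of weight `w` by
`q^(w, γ)`, so that `K_{ε_i} = σ_i` for `i` even and `K_{ε_i} = (σ_i τ_i)^{-1}` for `i` odd; `σ` is
the parity automorphism. -/
noncomputable def genOp (q : k) {m n : ℕ} {g : Series} :
    Gen m n g → Module.End k (Omega q m n)
  | .E j => omegaMul q m n (omegaVar q (lowIdx j)) ∘ₗ qDeriv q (highIdx j) ∘ₗ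
      diagOp q (sigmaEigenvalue q (lowIdx j))
  | .F j => diagOp q (fun a => (sigmaEigenvalue q (lowIdx j) a)⁻¹) ∘ₗ
      omegaMul q m n (omegaVar q (highIdx j)) ∘ₗ qDeriv q (lowIdx j)
  | .K γ => diagOp q fun a => q ^ weightForm (monomialWeight a) γ.1
  | .sigma => diagOp q fun a => (-1) ^ a.2.card

/-- `S` is a submodule of `Ω_q(m|n)` for the action `genOp` that is isomorphic, as a module over
`QAlg R`, to the highest weight module `V(λ)`, and `V(λ)` is simple. -/
def IsSimpleOfHighestWeight {m n : ℕ} {g : Series}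
    (R : FreeAlgebra k (Gen m n g) → FreeAlgebra k (Gen m n g) → Prop) (q : k)
    (wt : Fin (m + n) → ℤ) (S : Submodule k (Omega q m n)) : Prop :=
  IsSimpleModule (QAlg R) (SimpleHW R q wt) ∧
    ∃ φ : SimpleHW R q wt →ₗ[k] Omega q m n, Function.Injective φ ∧ LinearMap.range φ = S ∧
      ∀ (x : Gen m n g) (v : SimpleHW R q wt), φ (QAlg.gen R x • v) = genOp q x (φ v)

end QGrassmann

/-! On monomials the powers of `q` in $x_i$, $\partial_j$ and $\sigma_j$ cancel: $E_j$ and $F_j$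
move one unit of exponent between neighbouring variables, with a $q$-integer, $0$ or $1$ as
coefficient (`genOp_E_basis`, `genOp_F_basis`). They factor as a normalized multiplication times a
normalized derivative. Such operators in different variables commute, odd ones included, so the
defining relations reduce to identities in a single variable (`monomialAction_rel`).

Both cases use one cap $c$ on the even exponents. Either $c > t$, so that the cap is vacuous in
degree $t$ (generic $q$), or $[c+1]=0$, so that the cap cannot be crossed (restricted case,
$c=\ell-1$); in both, $[1],\dots,[c]$ are nonzero. A degree $t$ has at most one monomial $w$ in
which no unit can be moved to the left (`eq_of_isSaturated`). Any other monomial is moved to the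
left by some $E_j$ with nonzero coefficient, and every nonzero move is undone by the opposite one.
Distinct monomials stay distinct under a move, so $E_j$ loses no coordinate whose move coefficient
is nonzero. Hence a nonzero vector of the component can be raised to $w$ (`exists_map_eq_top`), and
$w$ generates the component (`exists_map_top_eq`). No projection to weight spaces is needed, so the
torus of $\mathfrak{sl}$ and roots of unity cause no trouble.

`simpleHW_of_representation` identifies such a module with $V(\lambda)$. The Verma module is its
highest weight line plus $\sum_j F_jM(\lambda)$, and the coordinate of $w$ vanishes on the images of
the $F_j$; so the kernel of $M(\lambda)\to S$ is the radical. The dimensions count capped monomials,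
through the coefficients of $((1-X^{c+1})/(1-X))^m$ (`card_boundedCompositions`). -/

namespace QGrassmann
open scoped TensorProduct
variable {k : Type*} [Field k]

/-! ### Highest weight modules over algebras satisfying the relations of $\mathcal U_q$ -/

section HighestWeightTheory

variable {m n : ℕ} {g : Series} {R : FreeAlgebra k (Gen m n g) → FreeAlgebra k (Gen m n g) → Prop}

/-- The quotient map from the free algebra. -/
noncomputable def QAlg.mk (R : FreeAlgebra k (Gen m n g) → FreeAlgebra k (Gen m n g) → Prop) :
    FreeAlgebra k (Gen m n g) →ₐ[k] QAlg R :=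
  RingQuot.mkAlgHom k R

theorem QAlg.mk_surjective : Function.Surjective (QAlg.mk R) :=
  RingQuot.mkAlgHom_surjective k R

theorem QAlg.mk_rel {a b : FreeAlgebra k (Gen m n g)} (h : R a b) : QAlg.mk R a = QAlg.mk R b :=
  RingQuot.mkAlgHom_rel k h

theorem QAlg.mk_ι (x : Gen m n g) : QAlg.mk R (FreeAlgebra.ι k x) = QAlg.gen R x := rfl

theorem QAlg.smul_mem_of_gen {M : Type*} [AddCommGroup M] [Module k M] [Module (QAlg R) M]
    [IsScalarTower k (QAlg R) M] (L : Submodule k M)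
    (h : ∀ (x : Gen m n g), ∀ y ∈ L, QAlg.gen R x • y ∈ L) (u : QAlg R) :
    ∀ y ∈ L, u • y ∈ L := by
  obtain ⟨a, rfl⟩ : ∃ a, QAlg.mk R a = u := QAlg.mk_surjective u
  induction a using FreeAlgebra.induction with
  | grade0 r => intro y hy; rw [AlgHom.commutes, algebraMap_smul]; exact L.smul_mem _ hy
  | grade1 i => exact h i
  | mul a b ha hb => intro y hy; rw [map_mul, mul_smul]; exact ha _ (hb _ hy)
  | add a b ha hb => intro y hy; rw [map_add, add_smul]; exact L.add_mem (ha _ hy) (hb _ hy)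

section Triangular

variable {q : k} (hR : ∀ {a b}, QRel q m n g a b → R a b)

include hR

theorem QAlg.gen_K_mul_F (γ : torusLattice m n g) (j) :
    QAlg.gen R (.K γ) * QAlg.gen R (.F j) =
      q ^ (-weightForm γ.1 (simpleRoot j)) • (QAlg.gen R (.F j) * QAlg.gen R (.K γ)) := by
  have := QAlg.mk_rel (hR (QRel.K_F γ j))
  simpa only [map_mul, map_smul, fE, fF, fK, fSigma, QAlg.mk_ι] using this

theorem QAlg.gen_E_mul_F_same (j) :
    QAlg.gen R (.E j) * QAlg.gen R (.F j) =
      parSign k j • (QAlg.gen R (.F j) * QAlg.gen R (.E j)) +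
      (qIdx q j - (qIdx q j)⁻¹)⁻¹ •
        (QAlg.gen R (.K (rootElt g j)) - QAlg.gen R (.K (-rootElt g j))) := by
  have := QAlg.mk_rel (hR (QRel.E_F_same j))
  simp only [map_mul, map_smul, map_sub] at this
  exact sub_eq_iff_eq_add'.1 this

theorem QAlg.gen_E_mul_F_ne {i j} (h : i ≠ j) :
    QAlg.gen R (.E i) * QAlg.gen R (.F j) = QAlg.gen R (.F j) * QAlg.gen R (.E i) := by
  have := QAlg.mk_rel (hR (QRel.E_F_ne i j h))
  simpa only [map_mul, fE, fF, fK, fSigma, QAlg.mk_ι] using this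

theorem QAlg.gen_sigma_mul_F (j) :
    QAlg.gen R .sigma * QAlg.gen R (.F j) =
      parSign k j • (QAlg.gen R (.F j) * QAlg.gen R .sigma) := by
  have h1 : QAlg.gen R .sigma * QAlg.gen R (.F j) * QAlg.gen R .sigma =
      parSign k j • QAlg.gen R (.F j) := by
    have := QAlg.mk_rel (hR (QRel.smash_F j))
    simpa only [map_mul, map_smul, fE, fF, fK, fSigma, QAlg.mk_ι] using this
  have h2 : QAlg.gen R .sigma * QAlg.gen R .sigma = 1 := by
    have := QAlg.mk_rel (hR QRel.smash_sq)
    simpa only [map_mul, map_one, fE, fF, fK, fSigma, QAlg.mk_ι] using this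
  rw [← smul_mul_assoc, ← h1, mul_assoc, h2, mul_one]

/-- The spanning half of the triangular decomposition: words in the $F_j$ applied to the highest
weight vector span $M(\lambda)$, because $K_\gamma$ and $\sigma$ scale such words and $E_i$ can be
commuted to the right until it kills the vector. Every nonempty word lies in $\sum_j F_jM(\lambda)$.
-/
theorem verma_exists_sub_mem_lower (wt : Fin (m + n) → ℤ) (x : Verma R q wt) :
    ∃ c : k, x - c • (Submodule.Quotient.mk 1 : Verma R q wt) ∈ vermaLower R q wt := by
  set v : Verma R q wt := Submodule.Quotient.mk 1 with hv
  let W : List (Fin (m + n - 1)) → Verma R q wt :=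
    fun l => (l.map fun j => QAlg.gen R (.F j)).prod • v
  have hWc : ∀ j l, W (j :: l) = QAlg.gen R (.F j) • W l := fun j l => by
    simp only [W, List.map_cons, List.prod_cons, mul_smul]
  have hWn : W [] = v := by simp [W]
  have hv0 : ∀ u : QAlg R, u ∈ vermaIdeal R q wt → u • v = 0 := by
    intro u hu
    rw [hv, ← Submodule.Quotient.mk_smul, smul_eq_mul, mul_one]
    exact (Submodule.Quotient.mk_eq_zero _).2 hu
  have hE : ∀ j, QAlg.gen R (.E j) • v = 0 := fun j =>
    hv0 _ (Submodule.subset_span (Or.inl (Or.inl ⟨j, rfl⟩)))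
  have hK : ∀ γ : torusLattice m n g, QAlg.gen R (.K γ) • v = q ^ weightForm wt γ.1 • v := by
    intro γ
    have := hv0 _ (Submodule.subset_span (Or.inl (Or.inr ⟨γ, rfl⟩)))
    rwa [sub_smul, sub_eq_zero, algebraMap_smul] at this
  have hs : QAlg.gen R .sigma • v = ((-1 : k) ^ oddDegree wt) • v := by
    have := hv0 _ (Submodule.subset_span (Or.inr rfl))
    rwa [sub_smul, sub_eq_zero, algebraMap_smul] at this
  have hKW : ∀ (γ : torusLattice m n g) l, ∃ c : k, QAlg.gen R (.K γ) • W l = c • W l := by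
    intro γ l
    induction l with
    | nil => exact ⟨_, hWn ▸ hK γ⟩
    | cons j l ih =>
      obtain ⟨c, hc⟩ := ih
      refine ⟨q ^ (-weightForm γ.1 (simpleRoot j)) * c, ?_⟩
      rw [hWc, ← mul_smul, QAlg.gen_K_mul_F hR, smul_assoc, mul_smul, hc, smul_comm _ c,
        mul_smul]
  have hsW : ∀ l, ∃ c : k, QAlg.gen R .sigma • W l = c • W l := by
    intro l
    induction l with
    | nil => exact ⟨_, hWn ▸ hs⟩
    | cons j l ih =>
      obtain ⟨c, hc⟩ := ih
      refine ⟨parSign k j * c, ?_⟩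
      rw [hWc, ← mul_smul, QAlg.gen_sigma_mul_F hR, smul_assoc, mul_smul, hc, smul_comm _ c,
        mul_smul]
  let L : Submodule k (Verma R q wt) := Submodule.span k (Set.range W)
  have hWL : ∀ l, W l ∈ L := fun l => Submodule.subset_span ⟨l, rfl⟩
  have hFL : ∀ j, ∀ y ∈ L, QAlg.gen R (.F j) • y ∈ L := by
    intro j y hy
    induction hy using Submodule.span_induction with
    | mem y hy => obtain ⟨l, rfl⟩ := hy; rw [← hWc]; exact hWL _
    | zero => rw [smul_zero]; exact L.zero_mem
    | add x y _ _ hx hy => rw [smul_add]; exact L.add_mem hx hy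
    | smul c x _ hx => rw [smul_comm]; exact L.smul_mem _ hx
  -- Induction on the word: passing $E_i$ over the first letter leaves a shorter instance and, if
  -- the indices agree, a torus term that scales the tail.
  have hEW : ∀ i l, QAlg.gen R (.E i) • W l ∈ L := by
    intro i l
    induction l with
    | nil => rw [hWn, hE]; exact L.zero_mem
    | cons j l ih =>
      rw [hWc, ← mul_smul]
      by_cases hij : i = j
      · subst hij
        obtain ⟨c, hc⟩ := hKW (rootElt g i) l
        obtain ⟨d, hd⟩ := hKW (-rootElt g i) l
        rw [QAlg.gen_E_mul_F_same hR, add_smul, smul_assoc, smul_assoc, sub_smul, hc, hd,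
          mul_smul]
        exact L.add_mem (L.smul_mem _ (hFL _ _ ih))
          (L.smul_mem _ (L.sub_mem (L.smul_mem _ (hWL l)) (L.smul_mem _ (hWL l))))
      · rw [QAlg.gen_E_mul_F_ne hR hij, mul_smul]
        exact hFL _ _ ih
  have hgen : ∀ (x : Gen m n g), ∀ y ∈ L, QAlg.gen R x • y ∈ L := by
    intro z y hy
    induction hy using Submodule.span_induction with
    | mem y hy =>
      obtain ⟨l, rfl⟩ := hy
      cases z with
      | E j => exact hEW j l
      | F j => exact hFL j _ (hWL l)
      | K γ => obtain ⟨c, hc⟩ := hKW γ l; rw [hc]; exact L.smul_mem _ (hWL l)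
      | sigma => obtain ⟨c, hc⟩ := hsW l; rw [hc]; exact L.smul_mem _ (hWL l)
    | zero => rw [smul_zero]; exact L.zero_mem
    | add x y _ _ hx hy => rw [smul_add]; exact L.add_mem hx hy
    | smul c x _ hx => rw [smul_comm]; exact L.smul_mem _ hx
  have hx : x ∈ L := by
    obtain ⟨u, rfl⟩ := Submodule.Quotient.mk_surjective _ x
    have := QAlg.smul_mem_of_gen L hgen u v (hWn ▸ hWL [])
    rwa [hv, ← Submodule.Quotient.mk_smul, smul_eq_mul, mul_one] at this
  induction hx using Submodule.span_induction with
  | mem y hy =>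
    obtain ⟨l, rfl⟩ := hy
    cases l with
    | nil => exact ⟨1, by rw [hWn, one_smul, sub_self]; exact Submodule.zero_mem _⟩
    | cons j l =>
      refine ⟨0, ?_⟩
      rw [zero_smul, sub_zero]
      exact Submodule.subset_span ⟨j, W l, hWc j l⟩
  | zero => exact ⟨0, by rw [zero_smul, sub_zero]; exact Submodule.zero_mem _⟩
  | add x y _ _ hx hy =>
    obtain ⟨c, hc⟩ := hx
    obtain ⟨d, hd⟩ := hy
    refine ⟨c + d, ?_⟩
    rw [add_smul, add_sub_add_comm]
    exact Submodule.add_mem _ hc hd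
  | smul c x _ hx =>
    obtain ⟨d, hd⟩ := hx
    refine ⟨c * d, ?_⟩
    rw [mul_smul, ← smul_sub]
    exact Submodule.smul_mem _ _ hd

/-- A representation on `S` with a highest weight vector `w`, in which every vector can be moved to
`w` and back, is the highest weight module of the weight of `w`, provided that some functional
separates `w` from the images of the `F_j`. -/
theorem simpleHW_of_representation {W : Type*} [AddCommGroup W] [Module k W]
    (ρ : QAlg R →ₐ[k] Module.End k W) (wt : Fin (m + n) → ℤ) (S : Submodule k W) (w : W)
    (f : W →ₗ[k] k) (hw : w ∈ S) (hS : ∀ x, ∀ y ∈ S, ρ (QAlg.gen R x) y ∈ S)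
    (hE : ∀ j, ρ (QAlg.gen R (.E j)) w = 0)
    (hK : ∀ γ : torusLattice m n g, ρ (QAlg.gen R (.K γ)) w = q ^ weightForm wt γ.1 • w)
    (hs : ρ (QAlg.gen R .sigma) w = ((-1 : k) ^ oddDegree wt) • w)
    (hf : f w ≠ 0) (hF : ∀ j, ∀ y ∈ S, f (ρ (QAlg.gen R (.F j)) y) = 0)
    (hdown : ∀ y ∈ S, ∃ u, ρ u w = y) (hup : ∀ y ∈ S, y ≠ 0 → ∃ u, ρ u y = w) :
    IsSimpleModule (QAlg R) (SimpleHW R q wt) ∧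
      ∃ φ : SimpleHW R q wt →ₗ[k] W, Function.Injective φ ∧ LinearMap.range φ = S ∧
        ∀ (x : Gen m n g) (v : SimpleHW R q wt), φ (QAlg.gen R x • v) = ρ (QAlg.gen R x) (φ v) := by
  let _ : Module (QAlg R) W := Module.compHom W ρ.toRingHom
  have hsm : ∀ (u : QAlg R) (y : W), u • y = ρ u y := fun _ _ => rfl
  have : IsScalarTower k (QAlg R) W := ⟨fun c u y => by rw [hsm, hsm, map_smul]; rfl⟩
  have hSu : ∀ (u : QAlg R), ∀ y ∈ S, u • y ∈ S := QAlg.smul_mem_of_gen S hS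
  let ψ : QAlg R →ₗ[QAlg R] W := LinearMap.toSpanSingleton _ _ w
  have hψ : vermaIdeal R q wt ≤ LinearMap.ker ψ := by
    refine Submodule.span_le.2 ?_
    rintro x ((⟨j, rfl⟩ | ⟨γ, rfl⟩) | rfl)
    · exact hE j
    · change (QAlg.gen R (.K γ) - _) • w = 0
      rw [sub_smul, sub_eq_zero, algebraMap_smul]; exact hK γ
    · change (QAlg.gen R .sigma - _) • w = 0
      rw [sub_smul, sub_eq_zero, algebraMap_smul]; exact hs
  let ψ₁ : Verma R q wt →ₗ[QAlg R] W := (vermaIdeal R q wt).liftQ ψ hψ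
  have hψ₁ : ∀ u : QAlg R, ψ₁ (Submodule.Quotient.mk u) = ρ u w := fun u => rfl
  have hψS : ∀ x, ψ₁ x ∈ S := by
    intro x
    obtain ⟨u, rfl⟩ := Submodule.Quotient.mk_surjective _ x
    exact hSu u w hw
  have hlow : ∀ x ∈ vermaLower R q wt, f (ψ₁ x) = 0 := by
    intro x hx
    induction hx using Submodule.span_induction with
    | mem y hy => obtain ⟨j, y, rfl⟩ := hy; rw [map_smul]; exact hF j _ (hψS y)
    | zero => simp
    | add x y _ _ hx hy => rw [map_add, map_add, hx, hy, add_zero]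
    | smul c x _ hx =>
      rw [LinearMap.map_smul_of_tower, map_smul, hx, smul_zero]
  -- The bound survives the supremum since `vermaLower` is closed under addition.
  have hradlow : ∀ x ∈ vermaRadical R q wt, x ∈ vermaLower R q wt := by
    intro x hx
    rw [vermaRadical, sSup_eq_iSup'] at hx
    induction hx using Submodule.iSup_induction' with
    | mem i x hx => exact i.2 x hx
    | zero => exact Submodule.zero_mem _
    | add x y _ _ hx hy => exact Submodule.add_mem _ hx hy
  -- If $x$ is in the kernel and $x-cv$ is in the lower part, then applying $f$ gives $c\,f(w)=0$,
  -- so $c=0$ and the kernel lies in the lower part. Conversely, a radical vector with nonzero image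
  -- could be moved to $w$ inside the radical, giving $f(w)=0$.
  have hker : LinearMap.ker ψ₁ = vermaRadical R q wt := by
    apply le_antisymm
    · apply le_sSup
      intro x hx
      obtain ⟨c, hc⟩ := verma_exists_sub_mem_lower hR wt x
      have h1 := hlow _ hc
      rw [map_sub, LinearMap.mem_ker.1 hx, zero_sub, LinearMap.map_smul_of_tower, hψ₁, map_one,
        Module.End.one_apply, map_neg, map_smul, neg_eq_zero, smul_eq_mul] at h1
      rcases mul_eq_zero.1 h1 with h | h
      · rwa [h, zero_smul, sub_zero] at hc
      · exact absurd h hf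
    · intro x hx
      by_contra hne
      obtain ⟨u, hu⟩ := hup _ (hψS x) hne
      refine hf ?_
      rw [← hu, ← hsm, ← map_smul]
      exact hlow _ (hradlow _ (Submodule.smul_mem _ u hx))
  let ψ₂ : SimpleHW R q wt →ₗ[QAlg R] W := (vermaRadical R q wt).liftQ ψ₁ hker.ge
  have hψ₂ : ∀ x, ψ₂ (Submodule.Quotient.mk x) = ψ₁ x := fun x => rfl
  have hinj : Function.Injective ψ₂ :=
    LinearMap.ker_eq_bot.1 (Submodule.ker_liftQ_eq_bot _ _ _ hker.le)
  have hψ₂S : ∀ x, ψ₂ x ∈ S := by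
    intro x
    obtain ⟨y, rfl⟩ := Submodule.Quotient.mk_surjective _ x
    exact hψS y
  have hw₂ : ψ₂ (Submodule.Quotient.mk (Submodule.Quotient.mk 1)) = w := by
    rw [hψ₂, hψ₁, map_one, Module.End.one_apply]
  refine ⟨?_, ψ₂.restrictScalars k, hinj, ?_, fun x v => map_smul ψ₂ _ _⟩
  -- Any nonzero vector generates: go up to $w$, then down to the target.
  · rw [isSimpleModule_iff_toSpanSingleton_surjective]
    constructor
    · refine ⟨⟨Submodule.Quotient.mk (Submodule.Quotient.mk 1), 0, fun h => hf ?_⟩⟩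
      rw [← hw₂, h, map_zero, map_zero]
    · intro x hx y
      have hx' : ψ₂ x ≠ 0 := fun h => hx (hinj (h.trans (map_zero _).symm))
      obtain ⟨u, hu⟩ := hup _ (hψ₂S x) hx'
      obtain ⟨u', hu'⟩ := hdown _ (hψ₂S y)
      refine ⟨u' * u, hinj ?_⟩
      rw [LinearMap.toSpanSingleton_apply, mul_smul, map_smul, map_smul, hsm, hsm, hu, hu']
  · apply le_antisymm
    · rintro _ ⟨x, rfl⟩; exact hψ₂S x
    · intro y hy
      obtain ⟨u, rfl⟩ := hdown y hy
      refine ⟨u • (Submodule.Quotient.mk (Submodule.Quotient.mk 1)), ?_⟩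
      rw [LinearMap.restrictScalars_apply, map_smul, hw₂, hsm]

end Triangular

end HighestWeightTheory

/-! ### Identities of $q$-integers -/

section QIntegers

variable {q : k}

theorem qInt_zero (q : k) : qInt q 0 = 0 := by simp [qInt]

theorem qInt_one (q : k) : qInt q 1 = 1 := by simp [qInt]

theorem qInt_succ (hq : q ≠ 0) (n : ℕ) : qInt q (n + 1) = q⁻¹ * qInt q n + q ^ n := by
  rw [qInt_add q hq, qInt_one]; simp

theorem sub_inv_mul_qInt (hq : q ≠ 0) (n : ℕ) :
    (q - q⁻¹) * qInt q n = q ^ (n : ℤ) - q ^ (-(n : ℤ)) := by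
  induction n with
  | zero => simp [qInt_zero]
  | succ n ih =>
    rw [qInt_succ hq, mul_add, mul_left_comm, ih, Nat.cast_succ, neg_add, zpow_add₀ hq,
      zpow_add₀ hq, zpow_natCast, zpow_one, zpow_neg_one]
    field_simp
    ring

theorem sub_inv_ne_zero (hq : q ≠ 0) (hq2 : q ^ 2 ≠ 1) : q - q⁻¹ ≠ 0 := by
  intro h
  apply hq2
  field_simp at h
  linear_combination h

theorem qInt_eq_div (hq : q ≠ 0) (hq2 : q ^ 2 ≠ 1) (n : ℕ) :
    qInt q n = (q - q⁻¹)⁻¹ * (q ^ (n : ℤ) - q ^ (-(n : ℤ))) := by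
  rw [← sub_inv_mul_qInt hq, inv_mul_cancel_left₀ (sub_inv_ne_zero hq hq2)]

/-- This recurrence is the quantum Serre relation in one even variable. -/
theorem qInt_three_term (hq : q ≠ 0) (hq2 : q ^ 2 ≠ 1) (n : ℕ) :
    qInt q (n + 2) - (q + q⁻¹) * qInt q (n + 1) + qInt q n = 0 := by
  apply mul_left_cancel₀ (sub_inv_ne_zero hq hq2)
  rw [mul_add, mul_sub, mul_left_comm, sub_inv_mul_qInt hq, sub_inv_mul_qInt hq,
    sub_inv_mul_qInt hq]
  push_cast
  simp only [neg_add, zpow_add₀ hq, zpow_one, zpow_neg_one,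
    show (2 : ℤ) = 1 + 1 from rfl]
  field_simp
  ring

theorem qBinom_zero_right (q : k) (n : ℕ) : qBinom q n 0 = 1 := by cases n <;> rfl

theorem qBinom_one_right (hq : q ≠ 0) (n : ℕ) : qBinom q n 1 = qInt q n := by
  induction n with
  | zero => simp [qInt_zero, qBinom]
  | succ n ih =>
    rw [qBinom, qBinom_zero_right, ih, add_comm n 1, qInt_add q hq, qInt_one]
    simp

theorem qInt_mul_eq_zero (hq : q ≠ 0) {l : ℕ} (h : qInt q l = 0) (r : ℕ) :
    qInt q (l * r) = 0 := by
  induction r with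
  | zero => exact qInt_zero q
  | succ r ih => rw [Nat.mul_succ, qInt_add q hq, ih, h]; simp

/-- $[\ell]=0$ forces $q^\ell=q^{-\ell}$; this gives $K_\gamma^{2\ell}=1$ on monomials. -/
theorem pow_two_mul_eq_one (hq : q ≠ 0) {l : ℕ} (h : qInt q l = 0) : q ^ (2 * l) = 1 := by
  have := sub_inv_mul_qInt hq l
  rw [h, mul_zero, eq_comm, sub_eq_zero, zpow_neg, zpow_natCast] at this
  rw [two_mul, pow_add]
  nth_rewrite 1 [this]
  exact inv_mul_cancel₀ (pow_ne_zero _ hq)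

end QIntegers

/-! ### Raising and lowering exponents of monomials -/

section Monomials

variable {m n : ℕ}

/-- The exponent of `x_i` in a monomial. -/
def expo (a : (Fin m → ℕ) × Finset (Fin n)) : Fin (m + n) → ℕ :=
  Fin.append a.1 (fun s => if s ∈ a.2 then 1 else 0)

/-- Increase the exponent of `x_i`. -/
def raise (i : Fin (m + n)) (a : (Fin m → ℕ) × Finset (Fin n)) : (Fin m → ℕ) × Finset (Fin n) :=
  Fin.addCases (fun s => (a.1 + Pi.single s 1, a.2)) (fun s => (a.1, insert s a.2)) i

/-- Decrease the exponent of `x_i`. -/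
def lower (i : Fin (m + n)) (a : (Fin m → ℕ) × Finset (Fin n)) : (Fin m → ℕ) × Finset (Fin n) :=
  Fin.addCases (fun s => (a.1 - Pi.single s 1, a.2)) (fun s => (a.1, a.2.erase s)) i

/-- The coefficient of the normalized multiplication by `x_i`. -/
def raiseCoeff (q : k) (i : Fin (m + n)) (a : (Fin m → ℕ) × Finset (Fin n)) : k :=
  Fin.addCases (fun s => qInt q (a.1 s + 1)) (fun s => if s ∈ a.2 then 0 else 1) i

/-- The coefficient of the normalized derivative `∂_i`. -/
def lowerCoeff (k : Type*) [Field k] (i : Fin (m + n)) (a : (Fin m → ℕ) × Finset (Fin n)) : k :=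
  if expo a i = 0 then 0 else 1

variable (q : k) (a : (Fin m → ℕ) × Finset (Fin n))

@[simp] theorem expo_castAdd (s : Fin m) : expo a (Fin.castAdd n s) = a.1 s := by simp [expo]
@[simp] theorem expo_natAdd (s : Fin n) :
    expo a (Fin.natAdd m s) = if s ∈ a.2 then 1 else 0 := by simp [expo]
@[simp] theorem raise_castAdd (s : Fin m) :
    raise (Fin.castAdd n s) a = (a.1 + Pi.single s 1, a.2) := by simp [raise]
@[simp] theorem raise_natAdd (s : Fin n) :
    raise (Fin.natAdd m s) a = (a.1, insert s a.2) := by simp [raise]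
@[simp] theorem lower_castAdd (s : Fin m) :
    lower (Fin.castAdd n s) a = (a.1 - Pi.single s 1, a.2) := by simp [lower]
@[simp] theorem lower_natAdd (s : Fin n) :
    lower (Fin.natAdd m s) a = (a.1, a.2.erase s) := by simp [lower]
@[simp] theorem raiseCoeff_castAdd (s : Fin m) :
    raiseCoeff q (Fin.castAdd n s) a = qInt q (a.1 s + 1) := by simp [raiseCoeff]
@[simp] theorem raiseCoeff_natAdd (s : Fin n) :
    raiseCoeff q (Fin.natAdd m s) a = if s ∈ a.2 then 0 else 1 := by simp [raiseCoeff]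

variable {a}

theorem expo_raise_of_ne {i j : Fin (m + n)} (h : i ≠ j) : expo (raise j a) i = expo a i := by
  induction i using Fin.addCases with
  | left s =>
    induction j using Fin.addCases with
    | left s' =>
      have : s ≠ s' := fun e => h (e ▸ rfl)
      simp [this]
    | right s' => simp
  | right s =>
    induction j using Fin.addCases with
    | left s' => simp
    | right s' =>
      have : s ≠ s' := fun e => h (e ▸ rfl)
      simp [this]

theorem expo_lower_of_ne {i j : Fin (m + n)} (h : i ≠ j) : expo (lower j a) i = expo a i := by
  induction i using Fin.addCases with
  | left s =>
    induction j using Fin.addCases with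
    | left s' =>
      have : s ≠ s' := fun e => h (e ▸ rfl)
      simp [this]
    | right s' => simp
  | right s =>
    induction j using Fin.addCases with
    | left s' => simp
    | right s' =>
      have : s ≠ s' := fun e => h (e ▸ rfl)
      simp [this]

theorem expo_lower_self (i : Fin (m + n)) : expo (lower i a) i = expo a i - 1 := by
  induction i using Fin.addCases with
  | left s => simp
  | right s => by_cases h : s ∈ a.2 <;> simp [h]

/-- The nonvanishing coefficient excludes an odd index that is already present, where `insert`
changes nothing. -/
theorem expo_raise_self {i : Fin (m + n)} (h : raiseCoeff q i a ≠ 0) :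
    expo (raise i a) i = expo a i + 1 := by
  induction i using Fin.addCases with
  | left s => simp
  | right s => by_cases hs : s ∈ a.2 <;> simp_all

/-- The coefficient depends on the $i$-th exponent alone, which is what decouples the variables. -/
theorem raiseCoeff_eq_ite (i : Fin (m + n)) : raiseCoeff q i a =
    if i.val < m then qInt q (expo a i + 1) else if expo a i = 0 then 1 else 0 := by
  induction i using Fin.addCases with
  | left s => simp
  | right s => by_cases hs : s ∈ a.2 <;> simp [hs]

/-- Monomials are separated by their weights in $\mathbb Z^{m+n}$; equalities of monomials are
checked on exponents from here on. -/
theorem expo_injective : Function.Injective (expo : (Fin m → ℕ) × Finset (Fin n) → _) := by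
  intro a b h
  refine Prod.ext (funext fun s => ?_) (Finset.ext fun s => ?_)
  · simpa using congrFun h (Fin.castAdd n s)
  · have := congrFun h (Fin.natAdd m s)
    by_cases h1 : s ∈ a.2 <;> by_cases h2 : s ∈ b.2 <;> simp_all

theorem expo_le_one {i : Fin (m + n)} (h : m ≤ i.val) : expo a i ≤ 1 := by
  induction i using Fin.addCases with
  | left s => have := s.2; simp at h; omega
  | right s => rw [expo_natAdd]; split_ifs <;> omega

theorem monomialWeight_eq_expo (i : Fin (m + n)) : monomialWeight a i = (expo a i : ℤ) := by
  induction i using Fin.addCases with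
  | left s => simp [monomialWeight]
  | right s => simp [monomialWeight]

theorem raise_comm (i j : Fin (m + n)) : raise i (raise j a) = raise j (raise i a) := by
  induction i using Fin.addCases with
  | left s => induction j using Fin.addCases with
    | left s' => simp [add_right_comm]
    | right s' => simp
  | right s => induction j using Fin.addCases with
    | left s' => simp
    | right s' => simp [Finset.insert_comm]

theorem lower_comm (i j : Fin (m + n)) : lower i (lower j a) = lower j (lower i a) := by
  induction i using Fin.addCases with
  | left s => induction j using Fin.addCases with
    | left s' => simp [tsub_right_comm]
    | right s' => simp
  | right s => induction j using Fin.addCases with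
    | left s' => simp
    | right s' => simp [Finset.erase_right_comm]

theorem raise_lower_comm {i j : Fin (m + n)} (h : i ≠ j) :
    raise i (lower j a) = lower j (raise i a) := by
  induction i using Fin.addCases with
  | left s => induction j using Fin.addCases with
    | left s' =>
      have hs : s ≠ s' := fun e => h (e ▸ rfl)
      simp only [raise_castAdd, lower_castAdd, Prod.mk.injEq, and_true]
      funext r
      by_cases h1 : r = s
      · subst h1; simp [hs]
      · simp [Pi.single_apply, h1]
    | right s' => simp
  | right s => induction j using Fin.addCases with
    | left s' => simp
    | right s' =>
      have hs : s ≠ s' := fun e => h (e ▸ rfl)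
      simp [Finset.erase_insert_of_ne hs]

theorem lower_raise_self {i : Fin (m + n)} (h : raiseCoeff q i a ≠ 0) :
    lower i (raise i a) = a := by
  induction i using Fin.addCases with
  | left s => simp
  | right s => by_cases hs : s ∈ a.2 <;> simp_all

theorem raise_lower_self {i : Fin (m + n)} (h : lowerCoeff k i a ≠ 0) :
    raise i (lower i a) = a := by
  induction i using Fin.addCases with
  | left s =>
    simp only [lowerCoeff, expo_castAdd] at h
    have h0 : a.1 s ≠ 0 := by simpa using h
    simp only [lower_castAdd, raise_castAdd]
    refine Prod.ext (funext fun r => ?_) rfl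
    by_cases hr : r = s
    · subst hr; simp; omega
    · simp [hr]
  | right s =>
    have h0 : s ∈ a.2 := by by_contra h0; simp [lowerCoeff, h0] at h
    simp [Finset.insert_erase h0]

end Monomials

/-! ### Normalized multiplications and derivatives -/

section Operators

variable {m n : ℕ} {V : Type*} [AddCommGroup V] [Module k V]
  (b : Module.Basis ((Fin m → ℕ) × Finset (Fin n)) k V) (q : k)

/-- The normalized multiplication by `x_i`. -/
noncomputable def raiseOp (i : Fin (m + n)) : Module.End k (V) :=
  b.constr k fun a => raiseCoeff q i a • b (raise i a)

/-- The normalized derivative `∂_i`. -/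
noncomputable def lowerOp (i : Fin (m + n)) : Module.End k (V) :=
  b.constr k fun a => lowerCoeff k i a • b (lower i a)

/-- The operator acting on each monomial by a scalar. -/
noncomputable def diagonalOp (c : (Fin m → ℕ) × Finset (Fin n) → k) : Module.End k V :=
  b.constr k fun a => c a • b a

variable (a : (Fin m → ℕ) × Finset (Fin n))

theorem raiseOp_basis (i : Fin (m + n)) : raiseOp b q i (b a) =
    raiseCoeff q i a • b (raise i a) :=
  Module.Basis.constr_basis ..

theorem lowerOp_basis (i : Fin (m + n)) : lowerOp b i (b a) =
    lowerCoeff k i a • b (lower i a) :=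
  Module.Basis.constr_basis ..

theorem diagonalOp_basis (c : (Fin m → ℕ) × Finset (Fin n) → k) :
    diagonalOp b c (b a) = c a • b a :=
  Module.Basis.constr_basis ..

variable {a}

/-- Normalization has removed the signs as well as the powers of $q$, so odd multiplications also
commute rather than anticommute. -/
theorem raiseOp_commute (i j : Fin (m + n)) : Commute (raiseOp b q i) (raiseOp b q j) := by
  refine b.ext fun a => ?_
  by_cases h : i = j
  · subst h; rfl
  simp only [Module.End.mul_apply, raiseOp_basis, map_smul, smul_smul, raise_comm i j,
    raiseCoeff_eq_ite, expo_raise_of_ne h, expo_raise_of_ne (Ne.symm h), mul_comm]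

theorem lowerOp_commute (i j : Fin (m + n)) : Commute (lowerOp b i) (lowerOp b j) := by
  refine b.ext fun a => ?_
  by_cases h : i = j
  · subst h; rfl
  simp only [Module.End.mul_apply, lowerOp_basis, map_smul, smul_smul, lower_comm i j,
    lowerCoeff, expo_lower_of_ne h, expo_lower_of_ne (Ne.symm h), mul_comm]

theorem raiseOp_lowerOp_commute {i j : Fin (m + n)} (h : i ≠ j) :
    Commute (raiseOp b q i) (lowerOp b j) := by
  refine b.ext fun a => ?_
  simp only [Module.End.mul_apply, lowerOp_basis, raiseOp_basis, map_smul, smul_smul,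
    raise_lower_comm h, lowerCoeff, raiseCoeff_eq_ite, expo_lower_of_ne h,
    expo_raise_of_ne (Ne.symm h), mul_comm]

/-- The $q$-Euler operator; odd variables fit the same formula because their exponent is $0$ or $1$,
and $[0]=0$, $[1]=1$. -/
theorem raiseOp_lowerOp_basis (i : Fin (m + n)) :
    raiseOp b q i (lowerOp b i (b a)) =
      qInt q (expo a i) • b a := by
  rw [lowerOp_basis, map_smul, raiseOp_basis, smul_smul]
  by_cases h : lowerCoeff k i a = 0
  · have h0 : expo a i = 0 := by by_contra h0; simp [lowerCoeff, h0] at h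
    rw [h, h0, qInt_zero, zero_mul, zero_smul, zero_smul]
  · have h0 : expo a i ≠ 0 := by intro h0; simp [lowerCoeff, h0] at h
    rw [raise_lower_self h, raiseCoeff_eq_ite, expo_lower_self, lowerCoeff, if_neg h0, one_mul]
    split_ifs with h1 h2
    · rw [Nat.sub_add_cancel (Nat.pos_of_ne_zero h0)]
    · rw [show expo a i = 1 by omega, qInt_one]
    · have := expo_le_one (a := a) (not_lt.1 h1); omega

theorem lowerOp_raiseOp_basis (i : Fin (m + n)) :
    lowerOp b i (raiseOp b q i (b a)) =
      raiseCoeff q i a • b a := by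
  rw [raiseOp_basis, map_smul, lowerOp_basis, smul_smul]
  by_cases h : raiseCoeff q i a = 0
  · rw [h, zero_mul, zero_smul, zero_smul]
  · rw [lower_raise_self q h, lowerCoeff, expo_raise_self q h, if_neg (Nat.succ_ne_zero _), mul_one]

theorem raiseOp_sq_of_odd {i : Fin (m + n)} (h : m ≤ i.val) : raiseOp b q i * raiseOp b q i = 0 := by
  refine b.ext fun a => ?_
  rw [Module.End.mul_apply, raiseOp_basis, map_smul, raiseOp_basis, smul_smul, LinearMap.zero_apply]
  by_cases hc : raiseCoeff q i a = 0
  · rw [hc, zero_mul, zero_smul]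
  · rw [raiseCoeff_eq_ite (a := raise i a), expo_raise_self q hc, if_neg (not_lt.2 h),
      if_neg (Nat.succ_ne_zero _), mul_zero, zero_smul]

theorem lowerOp_sq_of_odd {i : Fin (m + n)} (h : m ≤ i.val) : lowerOp b i * lowerOp b i = 0 := by
  refine b.ext fun a => ?_
  rw [Module.End.mul_apply, lowerOp_basis, map_smul, lowerOp_basis, smul_smul, LinearMap.zero_apply,
    lowerCoeff, lowerCoeff, expo_lower_self]
  have := expo_le_one (a := a) h
  rw [if_pos (c := expo a i - 1 = 0) (by omega), mul_zero, zero_smul]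

variable (hq : q ≠ 0) (hq2 : q ^ 2 ≠ 1)

-- On exponent $r+1$ the three terms carry $[r+2]$, $[r+1]$, $[r]$, so this is the three-term
-- recurrence; on exponent $0$ every term vanishes.
include hq hq2 in
theorem serre_lowerOp_raiseOp {i : Fin (m + n)} (h : i.val < m) :
    serre q (lowerOp b i) (raiseOp b q i) = 0 := by
  refine b.ext fun a => ?_
  simp only [serre, pow_two, LinearMap.add_apply, LinearMap.sub_apply, LinearMap.smul_apply,
    Module.End.mul_apply, lowerOp_raiseOp_basis, raiseOp_lowerOp_basis, map_smul,
    LinearMap.zero_apply]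
  rw [lowerOp_basis, map_smul, map_smul, raiseOp_lowerOp_basis, expo_lower_self,
    raiseCoeff_eq_ite, if_pos h, lowerCoeff]
  by_cases h0 : expo a i = 0
  · simp [h0]
  · obtain ⟨r, hr⟩ := Nat.exists_eq_add_one_of_ne_zero h0
    rw [hr, Nat.add_sub_cancel, if_neg (Nat.succ_ne_zero _)]
    match_scalars
    linear_combination qInt_three_term hq hq2 r

-- With exponent $e$, the common factor $[e+1]$ leaves the three-term recurrence at $e$.
include hq hq2 in
theorem serre_raiseOp_lowerOp {i : Fin (m + n)} (h : i.val < m) :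
    serre q (raiseOp b q i) (lowerOp b i) = 0 := by
  refine b.ext fun a => ?_
  simp only [serre, pow_two, LinearMap.add_apply, LinearMap.sub_apply, LinearMap.smul_apply,
    Module.End.mul_apply, lowerOp_raiseOp_basis, raiseOp_lowerOp_basis, map_smul,
    LinearMap.zero_apply]
  rw [raiseOp_basis, map_smul, map_smul, lowerOp_raiseOp_basis]
  by_cases hc : raiseCoeff q i a = 0
  · simp [hc]
  · rw [raiseCoeff_eq_ite (a := raise i a), if_pos h, expo_raise_self q hc,
      raiseCoeff_eq_ite (a := a), if_pos h]
    match_scalars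
    linear_combination qInt q (expo a i + 1) * qInt_three_term hq hq2 (expo a i)

end Operators

/-! ### Serre relators of products of commuting factors -/

section RingIdentities

variable {A B : Type*} [Ring A] [Algebra k A] [Ring B] [Algebra k B]

theorem map_serre (f : A →ₐ[k] B) (q : k) (X Y : A) :
    f (serre q X Y) = serre q (f X) (f Y) := by
  simp [serre]

theorem map_superSerre (f : A →ₐ[k] B) (q : k) (X Y Z : A) :
    f (superSerre q X Y Z) = superSerre q (f X) (f Y) (f Z) := by
  simp [superSerre]

/-- For neighbouring generators only $d$ and $x$ act on the same variable, so the other factors come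
out. The relator vanishes if that variable is even (Serre relation) or if $P^2=0$ (outer variable
odd). -/
theorem serre_mul_mul {P Q d x : A} (q : k) (hPd : Commute P d) (hPx : Commute P x)
    (hPQ : Commute P Q) (hQd : Commute Q d) :
    serre q (P * d) (Q * x) = P * P * Q * serre q d x := by
  simp only [serre, pow_two, mul_sub, mul_add, mul_smul_comm, mul_assoc,
    hPd.symm.left_comm, hPx.symm.left_comm, hPQ.symm.left_comm, hQd.symm.left_comm]

/-- Here $d,x$ share the last even variable and $e,y$ the first odd one. Two of the five terms
contain $e^2=0$; in the other three the odd part is $eye$, and their even parts add up to the Serre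
relator of $x$ and $d$. -/
theorem superSerre_mul_mul {P Q d x e y : A} (q : k) (hPx : Commute P x)
    (hPe : Commute P e) (hPy : Commute P y) (hPQ : Commute P Q) (hQd : Commute Q d)
    (hQx : Commute Q x) (hQe : Commute Q e) (hQy : Commute Q y) (hde : Commute d e)
    (hdy : Commute d y) (hxe : Commute x e) (hxy : Commute x y) (he : e * e = 0) :
    superSerre q (P * d) (x * e) (y * Q) = P * Q * serre q x d * (e * y * e) := by
  simp only [superSerre, serre, pow_two, mul_sub, mul_add, sub_mul, add_mul, mul_smul_comm,
    smul_mul_assoc, mul_assoc, he, mul_zero, zero_mul,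
    hPx.symm.left_comm, hPQ.symm.left_comm, hPe.symm.left_comm, hPy.symm.left_comm,
    hQd.symm.left_comm, hQx.symm.left_comm, hQe.symm.left_comm, hQy.symm.eq,
    hde.symm.eq, hde.symm.left_comm, hdy.symm.left_comm, hxe.symm.left_comm, hxy.symm.left_comm]
  abel

end RingIdentities

/-! ### The weight form and parity -/

section Weights

variable {m n : ℕ}

theorem weightForm_add_left (a b c : Fin (m + n) → ℤ) :
    weightForm (a + b) c = weightForm a c + weightForm b c := by
  simp only [weightForm, Pi.add_apply, mul_add, add_mul, Finset.sum_add_distrib]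

theorem weightForm_neg_left (a c : Fin (m + n) → ℤ) : weightForm (-a) c = -weightForm a c := by
  simp only [weightForm, Pi.neg_apply, mul_neg, neg_mul, Finset.sum_neg_distrib]

theorem weightForm_comm (a c : Fin (m + n) → ℤ) : weightForm a c = weightForm c a :=
  Finset.sum_congr rfl fun i _ => by ring

theorem weightForm_simpleRoot (a : Fin (m + n) → ℤ) (j : Fin (m + n - 1)) :
    weightForm a (simpleRoot j) = (if (lowIdx j).val < m then 1 else -1) * a (lowIdx j) -
      (if (highIdx j).val < m then 1 else -1) * a (highIdx j) := by
  simp only [weightForm, simpleRoot, Pi.sub_apply, mul_sub, Finset.sum_sub_distrib, Pi.single_apply,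
    mul_ite, mul_one, mul_zero, Finset.sum_ite_eq', Finset.mem_univ, if_true]

theorem lowIdx_ne_highIdx (j : Fin (m + n - 1)) : lowIdx j ≠ highIdx j := by
  intro h
  have := congrArg Fin.val h
  simp [lowIdx, highIdx] at this

theorem oddDegree_add (a b : Fin (m + n) → ℤ) :
    oddDegree (a + b) = oddDegree a + oddDegree b := by
  simp only [oddDegree, ← Finset.sum_add_distrib]
  exact Finset.sum_congr rfl fun i _ => by split_ifs <;> simp

theorem oddDegree_neg (a : Fin (m + n) → ℤ) : oddDegree (-a) = -oddDegree a := by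
  simp only [oddDegree, ← Finset.sum_neg_distrib]
  exact Finset.sum_congr rfl fun i _ => by split_ifs <;> simp

theorem oddDegree_single (i : Fin (m + n)) :
    oddDegree (Pi.single i 1 : Fin (m + n) → ℤ) = if i.val < m then 0 else 1 := by
  rw [oddDegree, Finset.sum_eq_single i]
  · simp
  · intro j _ hj; simp [hj]
  · simp

theorem neg_one_zpow_oddDegree_simpleRoot (j : Fin (m + n - 1)) :
    (-1 : k) ^ oddDegree (simpleRoot (m := m) (n := n) j) = parSign k j := by
  rw [simpleRoot, sub_eq_add_neg, oddDegree_add, oddDegree_neg, oddDegree_single, oddDegree_single,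
    parSign]
  simp only [lowIdx, highIdx]
  rcases lt_trichotomy (j.val + 1) m with h | h | h
  · simp [h, h.ne, show j.val < m by omega]
  · simp [h, show j.val < m by omega]
  · simp [h.ne', show ¬ j.val < m by omega, show ¬ j.val + 1 < m by omega]

theorem parSign_inv (j : Fin (m + n - 1)) : (parSign k j)⁻¹ = parSign k j := by
  rw [parSign]; split_ifs <;> simp

theorem oddDegree_monomialWeight (a : (Fin m → ℕ) × Finset (Fin n)) :
    oddDegree (monomialWeight a) = a.2.card := by
  rw [oddDegree, Fin.sum_univ_add]
  simp [monomialWeight]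

theorem monomialWeight_add_of_expo {a a' : (Fin m → ℕ) × Finset (Fin n)} {i j : Fin (m + n)}
    (h : expo a' + Pi.single j 1 = expo a + Pi.single i 1) :
    monomialWeight a' = monomialWeight a + (Pi.single i 1 - Pi.single j 1) := by
  funext s
  have := congrFun h s
  simp only [Pi.add_apply, Pi.sub_apply, Pi.single_apply, monomialWeight_eq_expo] at this ⊢
  split_ifs at this ⊢ <;> omega

end Weights

/-! ### The monomial action and its relations -/

section Action

variable {m n : ℕ} {V : Type*} [AddCommGroup V] [Module k V]
  (b : Module.Basis ((Fin m → ℕ) × Finset (Fin n)) k V) (q : k)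
  (a : (Fin m → ℕ) × Finset (Fin n))

/-- The operator that moves one unit of the exponent of `x_j` to `x_i`. -/
noncomputable def moveOp (i j : Fin (m + n)) : Module.End k V := raiseOp b q i * lowerOp b j

/-- The monomial obtained by moving one unit of the exponent of `x_j` to `x_i`. -/
def move (i j : Fin (m + n)) (a : (Fin m → ℕ) × Finset (Fin n)) :
    (Fin m → ℕ) × Finset (Fin n) := raise i (lower j a)

/-- The coefficient of `moveOp`. -/
def moveCoeff (i j : Fin (m + n)) (a : (Fin m → ℕ) × Finset (Fin n)) : k :=
  lowerCoeff k j a * raiseCoeff q i (lower j a)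

theorem moveOp_basis (i j : Fin (m + n)) :
    moveOp b q i j (b a) = moveCoeff q i j a • b (move i j a) := by
  rw [moveOp, Module.End.mul_apply, lowerOp_basis, map_smul, raiseOp_basis, smul_smul, move,
    moveCoeff]

variable {a} {q}

/-- Stated additively to avoid truncated subtraction. The coefficient must be nonzero: otherwise
lowering a zero exponent, or raising an odd exponent equal to $1$, would break the balance. -/
theorem expo_move {i j : Fin (m + n)} (h : i ≠ j) (hc : moveCoeff q i j a ≠ 0) :
    expo (move i j a) + Pi.single j 1 = expo a + Pi.single i 1 := by
  have h1 : expo a j ≠ 0 := fun h1 => hc (by rw [moveCoeff, lowerCoeff, if_pos h1, zero_mul])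
  have h2 : raiseCoeff q i (lower j a) ≠ 0 := right_ne_zero_of_mul hc
  funext s
  simp only [Pi.add_apply, move]
  by_cases hi : s = i
  · subst hi
    rw [expo_raise_self q h2, expo_lower_of_ne h]
    simp [h]
  · rw [expo_raise_of_ne hi]
    by_cases hj : s = j
    · subst hj
      rw [expo_lower_self]
      simp [hi]
      omega
    · rw [expo_lower_of_ne hj]
      simp [hi, hj]

theorem diagonalOp_mul_moveOp {i j : Fin (m + n)} (h : i ≠ j)
    (c : (Fin m → ℕ) × Finset (Fin n) → k) (d : k)
    (hc : ∀ a a', monomialWeight a' = monomialWeight a + (Pi.single i 1 - Pi.single j 1) →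
      c a' = d * c a) :
    diagonalOp b c * moveOp b q i j = d • (moveOp b q i j * diagonalOp b c) := by
  refine b.ext fun a => ?_
  rw [LinearMap.smul_apply, Module.End.mul_apply, Module.End.mul_apply, moveOp_basis, map_smul,
    diagonalOp_basis, diagonalOp_basis, map_smul, moveOp_basis]
  by_cases hm : moveCoeff q i j a = 0
  · rw [hm, zero_smul, zero_smul, smul_zero, smul_zero]
  · rw [hc a _ (monomialWeight_add_of_expo (expo_move h hm))]
    simp only [smul_smul]
    congr 1; ring

theorem diagonalOp_mul (c d : (Fin m → ℕ) × Finset (Fin n) → k) :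
    diagonalOp b c * diagonalOp b d = diagonalOp b (c * d) := by
  refine b.ext fun a => ?_
  rw [Module.End.mul_apply, diagonalOp_basis, map_smul, diagonalOp_basis, diagonalOp_basis,
    smul_smul, Pi.mul_apply, mul_comm]

theorem diagonalOp_one : diagonalOp b (1 : (Fin m → ℕ) × Finset (Fin n) → k) = 1 := by
  refine b.ext fun a => ?_
  rw [diagonalOp_basis, Pi.one_apply, one_smul, Module.End.one_apply]

theorem diagonalOp_pow (c : (Fin m → ℕ) × Finset (Fin n) → k) (r : ℕ) :
    diagonalOp b c ^ r = diagonalOp b (c ^ r) := by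
  induction r with
  | zero => rw [pow_zero, pow_zero, diagonalOp_one]
  | succ r ih => rw [pow_succ, ih, diagonalOp_mul, pow_succ]

variable (q)

theorem moveOp_commute {i j i' j' : Fin (m + n)} (h : i ≠ j') (h' : i' ≠ j) :
    Commute (moveOp b q i j) (moveOp b q i' j') :=
  ((raiseOp_commute b q i i').mul_right (raiseOp_lowerOp_commute b q h)).mul_left
    ((raiseOp_lowerOp_commute b q h').symm.mul_right (lowerOp_commute b j j'))

theorem moveOp_eq (i j : Fin (m + n)) (h : i ≠ j) :
    moveOp b q i j = lowerOp b j * raiseOp b q i :=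
  (raiseOp_lowerOp_commute b q h).eq

/-- Regrouping by variable gives $(x_i\partial_i)(\partial_jx_j)$, and both factors are diagonal. -/
theorem moveOp_mul_moveOp_basis {i j : Fin (m + n)} (h : i ≠ j) :
    moveOp b q i j (moveOp b q j i (b a)) =
      (qInt q (expo a i) * raiseCoeff q j a) • b a := by
  have : moveOp b q i j * moveOp b q j i =
      (raiseOp b q i * lowerOp b i) * (lowerOp b j * raiseOp b q j) := by
    rw [moveOp, moveOp, mul_assoc, mul_assoc]
    congr 1
    rw [(raiseOp_lowerOp_commute b q h.symm).eq]
    exact (lowerOp_commute b j i).left_comm _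
  rw [← Module.End.mul_apply, this, Module.End.mul_apply, Module.End.mul_apply,
    Module.End.mul_apply, lowerOp_raiseOp_basis, map_smul, map_smul, raiseOp_lowerOp_basis,
    smul_smul, mul_comm]

theorem raiseOp_pow_basis {i : Fin (m + n)} (h : i.val < m) (r : ℕ) :
    expo ((raise i)^[r] a) i = expo a i + r ∧ (raiseOp b q i ^ r) (b a) =
      (∏ s ∈ Finset.range r, qInt q (expo a i + s + 1)) • b ((raise i)^[r] a) := by
  induction r with
  | zero => simp
  | succ r ih =>
    rw [Function.iterate_succ_apply', pow_succ', Module.End.mul_apply, ih.2, map_smul,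
      raiseOp_basis, smul_smul, raiseCoeff_eq_ite, if_pos h, ih.1, Finset.prod_range_succ]
    refine ⟨?_, rfl⟩
    induction i using Fin.addCases with
    | left s =>
      have := ih.1
      simp only [expo_castAdd] at this
      simp [this, add_assoc]
    | right s => simp at h

variable {q}

theorem raiseOp_pow_eq_zero (hq : q ≠ 0) {l : ℕ} (hl : 2 ≤ l) (h : qInt q l = 0)
    (i : Fin (m + n)) : raiseOp b q i ^ l = 0 := by
  by_cases hi : i.val < m
  · refine b.ext fun a => ?_
    -- Among $\ell$ consecutive $q$-integers one has index divisible by $\ell$; the chosen $s$ makes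
    -- $e+s+1$ the next multiple of $\ell$ after the exponent $e$.
    rw [(raiseOp_pow_basis b q hi l).2, LinearMap.zero_apply,
      Finset.prod_eq_zero (i := l - 1 - expo a i % l), zero_smul]
    · rw [Finset.mem_range]; omega
    · have h1 := Nat.mod_lt (expo a i) (show 0 < l by omega)
      have h2 := Nat.div_add_mod (expo a i) l
      rw [show expo a i + (l - 1 - expo a i % l) + 1 = l * (expo a i / l + 1) by
        rw [mul_add]; omega]
      exact qInt_mul_eq_zero hq h _
  · obtain ⟨r, rfl⟩ := Nat.exists_eq_add_of_le hl
    rw [pow_add, pow_two, raiseOp_sq_of_odd b q (not_lt.1 hi), zero_mul]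

theorem moveOp_pow_eq_zero (hq : q ≠ 0) {l : ℕ} (hl : 2 ≤ l) (h : qInt q l = 0)
    {i j : Fin (m + n)} (hij : i ≠ j) : moveOp b q i j ^ l = 0 := by
  rw [moveOp, (raiseOp_lowerOp_commute b q hij).mul_pow, raiseOp_pow_eq_zero b hq hl h, zero_mul]

/-- The action of the generators in terms of the normalized operators. -/
noncomputable def monomialAction {g : Series} (q : k) : Gen m n g → Module.End k V
  | .E j => moveOp b q (lowIdx j) (highIdx j)
  | .F j => moveOp b q (highIdx j) (lowIdx j)
  | .K γ => diagonalOp b fun a => q ^ weightForm (monomialWeight a) γ.1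
  | .sigma => diagonalOp b fun a => (-1) ^ a.2.card

theorem sigma_conj_moveOp {i j : Fin (m + n)} (h : i ≠ j) (d : k)
    (hd : (-1 : k) ^ oddDegree (Pi.single i 1 - Pi.single j 1 : Fin (m + n) → ℤ) = d) :
    diagonalOp b (fun a => (-1) ^ a.2.card) * moveOp b q i j *
      diagonalOp b (fun a => (-1) ^ a.2.card) = d • moveOp b q i j := by
  have h1 : diagonalOp b (fun a => (-1 : k) ^ a.2.card) * diagonalOp b (fun a => (-1) ^ a.2.card) =
      1 := by
    rw [diagonalOp_mul, ← diagonalOp_one b]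
    congr 1
    funext a
    simp [← mul_pow]
  rw [diagonalOp_mul_moveOp b h _ d, smul_mul_assoc, mul_assoc, h1, mul_one]
  intro a a' ha
  rw [← zpow_natCast, ← zpow_natCast, ← oddDegree_monomialWeight, ← oddDegree_monomialWeight, ha,
    oddDegree_add, zpow_add₀ (by simp), hd, mul_comm]

/-- Write $x,y$ for the two exponents. Both even: $[x][y+1]-[y][x+1]=[x-y]$. At the odd root the
sign of the form turns the right side into $[x+y]$ with $y\le1$. Both odd: $x,y\le 1$, and
$q_j=q^{-1}$ compensates the reversed form. -/
theorem commutator_coeff (hq : q ≠ 0) (hq2 : q ^ 2 ≠ 1) (j : Fin (m + n - 1)) :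
    qInt q (expo a (lowIdx j)) * raiseCoeff q (highIdx j) a -
      parSign k j * (qInt q (expo a (highIdx j)) * raiseCoeff q (lowIdx j) a) =
    (qIdx q j - (qIdx q j)⁻¹)⁻¹ * (q ^ weightForm (monomialWeight a) (simpleRoot j) -
      q ^ (-weightForm (monomialWeight a) (simpleRoot j))) := by
  have h0 := sub_inv_ne_zero hq hq2
  have h0' : q⁻¹ - q ≠ 0 := by rwa [← neg_sub, neg_ne_zero]
  rw [weightForm_simpleRoot, monomialWeight_eq_expo, monomialWeight_eq_expo, raiseCoeff_eq_ite,
    raiseCoeff_eq_ite, parSign, qIdx]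
  have e1 : (lowIdx j).val = j.val := rfl
  have e2 : (highIdx j).val = j.val + 1 := rfl
  have l1 := @expo_le_one m n a (lowIdx j)
  have l2 := @expo_le_one m n a (highIdx j)
  rw [e1] at l1
  rw [e2] at l2
  rw [e1, e2]
  generalize expo a (lowIdx j) = x at *
  generalize expo a (highIdx j) = y at *
  rcases lt_trichotomy (j.val + 1) m with h | h | h
  · simp only [show j.val < m by omega, h, h.ne, if_true, if_false, one_mul]
    rw [qInt_eq_div hq hq2, qInt_eq_div hq hq2, qInt_eq_div hq hq2, qInt_eq_div hq hq2]
    push_cast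
    simp only [neg_add, sub_eq_add_neg (_ : ℤ), zpow_add₀ hq, zpow_one, zpow_neg]
    have hx := zpow_ne_zero (x : ℤ) hq
    have hy := zpow_ne_zero (y : ℤ) hq
    generalize q ^ (x : ℤ) = X at *
    generalize q ^ (y : ℤ) = Y at *
    apply mul_left_cancel₀ (mul_ne_zero h0 h0)
    field_simp
    ring
  · simp only [show j.val < m by omega, h, lt_irrefl, if_true, if_false, one_mul]
    have : y ≤ 1 := l2 (by omega)
    interval_cases y
    · simp [qInt_eq_div hq hq2]
    · simp [qInt_one, qInt_eq_div hq hq2 (x + 1)]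
  · have : x ≤ 1 := l1 (by omega)
    have : y ≤ 1 := l2 (by omega)
    simp only [show ¬ j.val < m by omega, show ¬ j.val + 1 < m by omega, h.ne', if_false]
    interval_cases x <;> interval_cases y <;> simp [qInt_zero, qInt_one]
    · rw [← neg_sub q⁻¹ q, mul_neg, inv_mul_cancel₀ h0']
    · rw [inv_mul_cancel₀ h0']

/-- The shared variable is $c$ and the squared factor is multiplication by $x_p$. For simple roots,
the last hypothesis says exactly that the squared generator is not the odd one. -/
theorem serre_moveOp_of_target (hq : q ≠ 0) (hq2 : q ^ 2 ≠ 1) {p c r : Fin (m + n)} (hpc : p ≠ c)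
    (hcr : c ≠ r) (hpr : p ≠ r) (h : c.val < m ∨ m ≤ p.val) :
    serre q (moveOp b q p c) (moveOp b q c r) = 0 := by
  rw [moveOp_eq b q c r hcr, moveOp, serre_mul_mul q (raiseOp_lowerOp_commute b q hpc)
    (raiseOp_commute b q p c) (raiseOp_lowerOp_commute b q hpr) (lowerOp_commute b r c)]
  rcases h with h | h
  · rw [serre_lowerOp_raiseOp b q hq hq2 h, mul_zero]
  · rw [raiseOp_sq_of_odd b q h, zero_mul, zero_mul]

/-- The mirror case: the squared outer factor is now the derivative in $p$. -/
theorem serre_moveOp_of_source (hq : q ≠ 0) (hq2 : q ^ 2 ≠ 1) {p c r : Fin (m + n)} (hpc : p ≠ c) (hpr : p ≠ r) (h : c.val < m ∨ m ≤ p.val) :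
    serre q (moveOp b q c p) (moveOp b q r c) = 0 := by
  rw [moveOp_eq b q c p hpc.symm, moveOp, serre_mul_mul q
    (raiseOp_lowerOp_commute b q hpc.symm).symm (lowerOp_commute b p c)
    (raiseOp_lowerOp_commute b q hpr.symm).symm (raiseOp_commute b q r c)]
  rcases h with h | h
  · rw [serre_raiseOp_lowerOp b q hq hq2 h, mul_zero]
  · rw [lowerOp_sq_of_odd b h, zero_mul, zero_mul]

theorem superSerre_moveOp_up (hq : q ≠ 0) (hq2 : q ^ 2 ≠ 1) {a b' c d : Fin (m + n)}
    (hac : a ≠ c) (had : a ≠ d) (hbc : b' ≠ c) (hbd : b' ≠ d) (hcd : c ≠ d)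
    (hb : b'.val < m) (hc : m ≤ c.val) :
    superSerre q (moveOp b q a b') (moveOp b q b' c) (moveOp b q c d) = 0 := by
  rw [moveOp, moveOp, moveOp, superSerre_mul_mul q (raiseOp_commute b q _ _)
    (raiseOp_lowerOp_commute b q hac) (raiseOp_commute b q _ _) (raiseOp_lowerOp_commute b q had)
    (lowerOp_commute b _ _) (raiseOp_lowerOp_commute b q hbd).symm (lowerOp_commute b _ _)
    (raiseOp_lowerOp_commute b q hcd).symm (lowerOp_commute b _ _)
    (raiseOp_lowerOp_commute b q hbc.symm).symm (raiseOp_lowerOp_commute b q hbc)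
    (raiseOp_commute b q _ _) (lowerOp_sq_of_odd b hc), serre_raiseOp_lowerOp b q hq hq2 hb,
    mul_zero, zero_mul]

theorem superSerre_moveOp_down (hq : q ≠ 0) (hq2 : q ^ 2 ≠ 1) {a b' c d : Fin (m + n)}
    (hab : a ≠ b') (hac : a ≠ c) (had : a ≠ d) (hbc : b' ≠ c) (hbd : b' ≠ d) (hcd : c ≠ d)
    (hb : b'.val < m) (hc : m ≤ c.val) :
    superSerre q (moveOp b q b' a) (moveOp b q c b') (moveOp b q d c) = 0 := by
  rw [moveOp_eq b q _ _ hab.symm, moveOp_eq b q _ _ hbc.symm, moveOp_eq b q _ _ hcd.symm,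
    superSerre_mul_mul q (lowerOp_commute b _ _)
    (raiseOp_lowerOp_commute b q hac.symm).symm (lowerOp_commute b _ _)
    (raiseOp_lowerOp_commute b q had.symm).symm
    (raiseOp_commute b q _ _) (raiseOp_lowerOp_commute b q hbd.symm) (raiseOp_commute b q _ _)
    (raiseOp_lowerOp_commute b q hcd.symm) (raiseOp_commute b q _ _)
    (raiseOp_lowerOp_commute b q hbc) (raiseOp_lowerOp_commute b q hbc.symm).symm
    (lowerOp_commute b _ _) (raiseOp_sq_of_odd b q hc), serre_lowerOp_raiseOp b q hq hq2 hb,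
    mul_zero, zero_mul]

theorem diagonalOp_weight_mul_moveOp (hq : q ≠ 0) {i j : Fin (m + n)} (h : i ≠ j)
    (γ : Fin (m + n) → ℤ) :
    diagonalOp b (fun a => q ^ weightForm (monomialWeight a) γ) * moveOp b q i j =
      q ^ weightForm γ (Pi.single i 1 - Pi.single j 1) •
        (moveOp b q i j * diagonalOp b fun a => q ^ weightForm (monomialWeight a) γ) := by
  apply diagonalOp_mul_moveOp b h
  intro a a' ha
  rw [ha, weightForm_add_left, zpow_add₀ hq, mul_comm, weightForm_comm _ γ]

/-- Torus relations compare scalars, distant generators involve no raise and lower in a common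
variable, and the Serre relators reduce to the one or two shared variables. Squares at the odd root
contain a squared odd operator. -/
theorem monomialAction_rel {g : Series} (hq : q ≠ 0) (hq2 : q ^ 2 ≠ 1)
    {x y : FreeAlgebra k (Gen m n g)} (h : QRel q m n g x y) :
    FreeAlgebra.lift k (monomialAction b q) x = FreeAlgebra.lift k (monomialAction b q) y := by
  have hlow : ∀ j : Fin (m + n - 1), (lowIdx j : Fin (m + n)).val = j.val := fun _ => rfl
  have hhigh : ∀ j : Fin (m + n - 1), (highIdx j : Fin (m + n)).val = j.val + 1 := fun _ => rfl
  have ne : ∀ {x y : Fin (m + n)}, x.val ≠ y.val → x ≠ y := fun h => Fin.ne_of_val_ne h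
  have hz : ∀ a : (Fin m → ℕ) × Finset (Fin n), weightForm (monomialWeight a) 0 = 0 := fun a => by
    simp [weightForm]
  have hroot : ∀ j : Fin (m + n - 1),
      (Pi.single (highIdx j) 1 - Pi.single (lowIdx j) 1 : Fin (m + n) → ℤ) = -simpleRoot j :=
    fun j => by rw [simpleRoot, neg_sub]
  cases h <;> simp only [map_mul, map_sub, map_smul, map_pow, map_zero, map_one, map_serre,
    map_superSerre, fE, fF, fK, fSigma, FreeAlgebra.lift_ι_apply, monomialAction]
  case K_zero =>
    rw [← diagonalOp_one b]
    congr 1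
    funext a
    simp [hz]
  case K_add γ δ =>
    rw [diagonalOp_mul]
    congr 1
    funext a
    rw [Pi.mul_apply, ← zpow_add₀ hq, AddSubgroup.coe_add, weightForm_comm, weightForm_add_left,
      weightForm_comm, weightForm_comm _ δ.1]
  case K_E γ j => exact diagonalOp_weight_mul_moveOp b hq (lowIdx_ne_highIdx j) γ.1
  case K_F γ j =>
    rw [diagonalOp_weight_mul_moveOp b hq (lowIdx_ne_highIdx j).symm γ.1, hroot,
      weightForm_comm, weightForm_neg_left, weightForm_comm]
  case E_F_same j =>
    refine b.ext fun a => ?_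
    rw [LinearMap.sub_apply, LinearMap.smul_apply, LinearMap.smul_apply, LinearMap.sub_apply,
      Module.End.mul_apply, Module.End.mul_apply, moveOp_mul_moveOp_basis b q (lowIdx_ne_highIdx j),
      moveOp_mul_moveOp_basis b q (lowIdx_ne_highIdx j).symm, diagonalOp_basis, diagonalOp_basis,
      smul_smul, ← sub_smul, ← sub_smul, smul_smul, commutator_coeff hq hq2]
    congr 4
    -- The lattice element `-rootElt g j` has underlying vector `-simpleRoot j`, which supplies the
    -- second exponential of the commutator.
    change _ = weightForm (monomialWeight a) (-simpleRoot j)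
    rw [weightForm_comm _ (-simpleRoot j), weightForm_neg_left, weightForm_comm]
  case E_F_ne i j h =>
    have : i.val ≠ j.val := Fin.val_ne_of_ne h
    exact moveOp_commute b q (ne (by rw [hlow, hlow]; exact this))
      (ne (by rw [hhigh, hhigh]; omega))
  case E_comm i j h =>
    exact moveOp_commute b q (ne (by rw [hlow, hhigh]; omega)) (ne (by rw [hlow, hhigh]; omega))
  case F_comm i j h =>
    exact moveOp_commute b q (ne (by rw [hlow, hhigh]; omega)) (ne (by rw [hlow, hhigh]; omega))
  case E_serre i j h hi =>
    rcases h with h | h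
    · rw [show lowIdx j = highIdx i from Fin.ext h.symm]
      exact serre_moveOp_of_target b hq hq2 (lowIdx_ne_highIdx i)
        (ne (by rw [hhigh, hhigh]; omega)) (ne (by rw [hlow, hhigh]; omega))
        (by rw [hlow, hhigh]; omega)
    · rw [show highIdx j = lowIdx i from Fin.ext h]
      exact serre_moveOp_of_source b hq hq2 (lowIdx_ne_highIdx i).symm
        (ne (by rw [hlow, hhigh]; omega))
        (by rw [hlow, hhigh]; omega)
  case F_serre i j h hi =>
    rcases h with h | h
    · rw [show lowIdx j = highIdx i from Fin.ext h.symm]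
      exact serre_moveOp_of_source b hq hq2 (lowIdx_ne_highIdx i)
        (ne (by rw [hlow, hhigh]; omega)) (by rw [hlow, hhigh]; omega)
    · rw [show highIdx j = lowIdx i from Fin.ext h]
      exact serre_moveOp_of_target b hq hq2 (lowIdx_ne_highIdx i).symm
        (ne (by rw [hlow, hlow]; omega)) (ne (by rw [hlow, hhigh]; omega))
        (by rw [hlow, hhigh]; omega)
  case E_odd j h =>
    rw [moveOp, (raiseOp_lowerOp_commute b q (lowIdx_ne_highIdx j)).mul_pow, pow_two (lowerOp _ _),
      lowerOp_sq_of_odd b (by rw [hhigh]; omega), mul_zero]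
  case F_odd j h =>
    rw [moveOp, (raiseOp_lowerOp_commute b q (lowIdx_ne_highIdx j).symm).mul_pow,
      pow_two (raiseOp _ _ _), raiseOp_sq_of_odd b q (by rw [hhigh]; omega), zero_mul]
  case E_super i j l hab hb hbc =>
    rw [show lowIdx j = highIdx i from Fin.ext hab.symm, show lowIdx l = highIdx j from
      Fin.ext hbc.symm]
    apply superSerre_moveOp_up b hq hq2 <;> (try apply ne) <;> simp only [hlow, hhigh] <;> omega
  case F_super i j l hab hb hbc =>
    rw [show lowIdx j = highIdx i from Fin.ext hab.symm, show lowIdx l = highIdx j from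
      Fin.ext hbc.symm]
    apply superSerre_moveOp_down b hq hq2 <;> (try apply ne) <;> simp only [hlow, hhigh] <;> omega
  case smash_sq =>
    rw [diagonalOp_mul, ← diagonalOp_one b]
    congr 1
    funext a
    simp [← mul_pow]
  case smash_K γ =>
    rw [diagonalOp_mul, diagonalOp_mul]
    congr 1
    funext a
    simp [mul_right_comm, ← mul_pow]
  case smash_E j =>
    exact sigma_conj_moveOp b (lowIdx_ne_highIdx j) _ (neg_one_zpow_oddDegree_simpleRoot j)
  case smash_F j =>
    apply sigma_conj_moveOp b (lowIdx_ne_highIdx j).symm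
    rw [hroot, oddDegree_neg, zpow_neg, neg_one_zpow_oddDegree_simpleRoot, parSign_inv]

theorem monomialAction_restricted_rel {g : Series} (hq : q ≠ 0) (hq2 : q ^ 2 ≠ 1) {l : ℕ}
    (hl : 2 ≤ l) (h0 : qInt q l = 0) {x y : FreeAlgebra k (Gen m n g)}
    (h : RestrictedQRel q l m n g x y) :
    FreeAlgebra.lift k (monomialAction b q) x = FreeAlgebra.lift k (monomialAction b q) y := by
  cases h with
  | base h => exact monomialAction_rel b hq hq2 h
  | E_pow j h =>
    rw [map_pow, map_zero, fE, FreeAlgebra.lift_ι_apply]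
    exact moveOp_pow_eq_zero b hq hl h0 (lowIdx_ne_highIdx j)
  | F_pow j h =>
    rw [map_pow, map_zero, fF, FreeAlgebra.lift_ι_apply]
    exact moveOp_pow_eq_zero b hq hl h0 (lowIdx_ne_highIdx j).symm
  | K_pow γ =>
    rw [map_pow, map_one, fK, FreeAlgebra.lift_ι_apply, monomialAction, diagonalOp_pow,
      ← diagonalOp_one b]
    congr 1
    funext a
    rw [Pi.pow_apply, ← zpow_natCast, zpow_comm, zpow_natCast, pow_two_mul_eq_one hq h0, one_zpow,
      Pi.one_apply]

end Action

/-! ### Comparison with the operators on $\Omega_q(m|n)$ -/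

section OmegaAction

variable {m n : ℕ} (q : k)

theorem extBasis_apply (p : k) (n : ℕ) (μ : Finset (Fin n)) :
    extBasis p n μ = extMonomial p μ := by
  rw [extBasis, Module.Basis.mk_apply]

theorem extRep_gen (p : k) {n : ℕ} (i : Fin n) : extRep p n (extGen p i) = extShift p i :=
  (RingQuot.liftAlgHom_mkAlgHom_apply k _ (extShift_rel p) _).trans (FreeAlgebra.lift_ι_apply _ _)

/-- The left regular representation applied to the empty monomial is the coordinate isomorphism, so
the product can be read off from `extShift`. -/
theorem extGen_mul_extMonomial (p : k) {n : ℕ} (s : Fin n) (μ : Finset (Fin n)) :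
    extGen p s * extMonomial p μ =
      if s ∈ μ then 0 else (-p⁻¹) ^ (μ.filter (· < s)).card • extMonomial p (insert s μ) := by
  let f : QExterior p n →ₗ[k] (Finset (Fin n) →₀ k) :=
    (LinearMap.applyₗ (Finsupp.single ∅ 1)).comp (extRep p n).toLinearMap
  have hf : ∀ μ, f (extMonomial p μ) = Finsupp.single μ 1 := extRep_monomial p
  have hinj : Function.Injective f := by
    have : f = (extBasis p n).repr.toLinearMap := by
      refine (extBasis p n).ext fun μ => ?_
      rw [LinearEquiv.coe_coe, Module.Basis.repr_self, extBasis_apply, hf]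
    rw [this]
    exact (extBasis p n).repr.injective
  apply hinj
  have : f (extGen p s * extMonomial p μ) = extShift p s (f (extMonomial p μ)) := by
    change extRep p n _ _ = extShift p s (extRep p n _ _)
    rw [map_mul, Module.End.mul_apply, extRep_gen]
  rw [this, hf, extShift_single]
  split_ifs
  · rw [map_zero]
  · rw [map_smul, hf]

theorem extMonomial_singleton (p : k) {n : ℕ} (s : Fin n) : extMonomial p {s} = extGen p s := by
  simp [extMonomial]

theorem extMonomial_empty (p : k) (n : ℕ) : extMonomial p (∅ : Finset (Fin n)) = 1 := by
  simp [extMonomial]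

theorem omegaBasis_apply (a : (Fin m → ℕ) × Finset (Fin n)) :
    omegaBasis q m n a = divPowBasis k m a.1 ⊗ₜ extMonomial q⁻¹ a.2 := by
  rw [omegaBasis, Module.Basis.tensorProduct_apply', extBasis_apply]

theorem omegaMul_basis (a b : (Fin m → ℕ) × Finset (Fin n)) :
    omegaMul q m n (omegaBasis q m n a) (omegaBasis q m n b) = q ^ (a.2.card * ∑ i, b.1 i) •
      (divPowMul q m (divPowBasis k m a.1) (divPowBasis k m b.1) ⊗ₜ[k]
        (extMonomial q⁻¹ a.2 * extMonomial q⁻¹ b.2)) := by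
  rw [omegaMul, Module.Basis.constr_basis, Module.Basis.constr_basis]

theorem divPowMul_basis (β γ : Fin m → ℕ) :
    divPowMul q m (divPowBasis k m β) (divPowBasis k m γ) =
      (q ^ starProd β γ * ∏ i, qBinom q (β i + γ i) (β i)) • divPowBasis k m (β + γ) := by
  rw [divPowMul, Module.Basis.constr_basis, Module.Basis.constr_basis]

/-- The eigenvalue of `σ_i` on a monomial, with a natural number as exponent. -/
def sigmaValue (i : Fin (m + n)) (a : (Fin m → ℕ) × Finset (Fin n)) : k :=
  (if i.val < m then q else -q) ^ expo a i

/-- The product of the eigenvalues of `σ_s` for `s < i`. -/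
def sigmaProd (i : Fin (m + n)) (a : (Fin m → ℕ) × Finset (Fin n)) : k :=
  ∏ s : Fin (m + n), if s < i then sigmaValue q s a else 1

variable (a : (Fin m → ℕ) × Finset (Fin n))

theorem sigmaValue_castAdd (s : Fin m) : sigmaValue q (Fin.castAdd n s) a = q ^ a.1 s := by
  rw [sigmaValue, expo_castAdd, Fin.val_castAdd, if_pos s.2]

theorem sigmaValue_natAdd (s : Fin n) :
    sigmaValue q (Fin.natAdd m s) a = if s ∈ a.2 then -q else 1 := by
  rw [sigmaValue, expo_natAdd, Fin.val_natAdd, if_neg (by omega)]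
  split_ifs <;> simp

theorem sigmaProd_castAdd (s : Fin m) :
    sigmaProd q (Fin.castAdd n s) a = q ^ ∑ j ∈ Finset.Iio s, a.1 j := by
  rw [sigmaProd, Fin.prod_univ_add, Finset.prod_eq_one (f := fun i : Fin n => _), mul_one,
    ← Finset.prod_pow_eq_pow_sum, Finset.prod_ite, Finset.prod_const_one, mul_one]
  · refine Finset.prod_congr ?_ fun x _ => sigmaValue_castAdd q a x
    ext x
    simp only [Finset.mem_filter, Finset.mem_univ, true_and, Finset.mem_Iio]
    exact Iff.rfl
  · intro x _
    rw [if_neg]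
    rw [Fin.lt_def, Fin.val_natAdd, Fin.val_castAdd]
    omega

theorem sigmaProd_natAdd (s : Fin n) : sigmaProd q (Fin.natAdd m s) a =
    q ^ (∑ j, a.1 j) * (-q) ^ (a.2.filter (· < s)).card := by
  rw [sigmaProd, Fin.prod_univ_add]
  congr 1
  · rw [← Finset.prod_pow_eq_pow_sum]
    refine Finset.prod_congr rfl fun x _ => ?_
    rw [if_pos, sigmaValue_castAdd]
    rw [Fin.lt_def, Fin.val_natAdd, Fin.val_castAdd]
    omega
  · rw [← Finset.prod_const, Finset.prod_filter, ← Finset.prod_subset (Finset.subset_univ a.2)]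
    · refine Finset.prod_congr rfl fun x hx => ?_
      rw [sigmaValue_natAdd, if_pos hx]
      exact if_congr (by rw [Fin.lt_def, Fin.val_natAdd, Fin.val_natAdd, Fin.lt_def]; omega) rfl rfl
    · intro x _ hx
      rw [sigmaValue_natAdd, if_neg hx, ite_self]

variable {a} {q}

theorem sigmaProd_congr {a' : (Fin m → ℕ) × Finset (Fin n)} {i : Fin (m + n)}
    (h : ∀ s < i, expo a s = expo a' s) : sigmaProd q i a = sigmaProd q i a' :=
  Finset.prod_congr rfl fun s _ => by
    split_ifs with hs
    · rw [sigmaValue, sigmaValue, h s hs]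
    · rfl

theorem sigmaValue_ne_zero (hq : q ≠ 0) (i : Fin (m + n)) : sigmaValue q i a ≠ 0 := by
  refine pow_ne_zero _ ?_
  split_ifs <;> simpa

theorem sigmaProd_ne_zero (hq : q ≠ 0) (i : Fin (m + n)) : sigmaProd q i a ≠ 0 :=
  Finset.prod_ne_zero_iff.2 fun s _ => by
    split_ifs
    · exact sigmaValue_ne_zero hq s
    · exact one_ne_zero

theorem sigmaProd_highIdx (j : Fin (m + n - 1)) :
    sigmaProd q (highIdx j) a = sigmaProd q (lowIdx j) a * sigmaValue q (lowIdx j) a := by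
  have h : sigmaValue q (lowIdx j) a =
      ∏ s : Fin (m + n), if s = lowIdx j then sigmaValue q s a else 1 := by
    rw [Finset.prod_ite_eq' Finset.univ, if_pos (Finset.mem_univ _)]
  rw [h, sigmaProd, sigmaProd, ← Finset.prod_mul_distrib]
  refine Finset.prod_congr rfl fun s _ => ?_
  have h1 : (s < highIdx j) ↔ s.val < j.val + 1 := Iff.rfl
  have h2 : (s < lowIdx j) ↔ s.val < j.val := Iff.rfl
  have h3 : (s = lowIdx j) ↔ s.val = j.val := Fin.ext_iff
  simp only [h1, h2, h3]
  rcases lt_trichotomy s.val j.val with h | h | h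
  · rw [if_pos (by omega), if_pos h, if_neg (by omega), mul_one]
  · rw [if_pos (by omega), if_neg (by omega), if_pos h, one_mul]
  · rw [if_neg (by omega), if_neg (by omega), if_neg (by omega), mul_one]

theorem sigmaEigenvalue_eq (i : Fin (m + n)) : sigmaEigenvalue q i a = sigmaValue q i a := by
  rw [sigmaEigenvalue, monomialWeight_eq_expo, zpow_natCast, sigmaValue]

theorem qBinom_prod_single (hq : q ≠ 0) (β : Fin m → ℕ) (s : Fin m) :
    ∏ i, qBinom q ((Pi.single s 1 : Fin m → ℕ) i + β i) ((Pi.single s 1 : Fin m → ℕ) i) =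
      qInt q (β s + 1) := by
  rw [Finset.prod_eq_single s]
  · rw [Pi.single_eq_same, qBinom_one_right hq, add_comm]
  · intro i _ hi
    rw [Pi.single_eq_of_ne hi, qBinom_zero_right]
  · simp

theorem starProd_single (β : Fin m → ℕ) (s : Fin m) :
    starProd (Pi.single s 1) β = ∑ j ∈ Finset.Iio s, β j := by
  rw [starProd, Finset.sum_eq_single s]
  · simp
  · intro i _ hi
    simp [Pi.single_eq_of_ne hi]
  · simp

/-- The $q$-power from moving $x_i$ past the earlier variables is the product of the $\sigma_s$,
$s<i$. For odd $i$, the even part $q^{|\beta|}$ is the twist in the product of $\Omega_q(m|n)$ and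
the powers of $-q$ come from the exterior relations. -/
theorem omegaVar_mul_basis (hq : q ≠ 0) (i : Fin (m + n)) :
    omegaMul q m n (omegaVar q i) (omegaBasis q m n a) =
      (sigmaProd q i a * raiseCoeff q i a) • omegaBasis q m n (raise i a) := by
  induction i using Fin.addCases with
  | left s =>
    rw [omegaVar, Fin.addCases_left, omegaMul_basis, divPowMul_basis, extMonomial_empty, one_mul,
      Finset.card_empty, zero_mul, pow_zero, one_smul, qBinom_prod_single hq, starProd_single,
      sigmaProd_castAdd, raiseCoeff_castAdd, raise_castAdd, omegaBasis_apply,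
      TensorProduct.smul_tmul', show ((Pi.single s 1, (∅ : Finset (Fin n))) :
        (Fin m → ℕ) × Finset (Fin n)).1 + a.1 = a.1 + Pi.single s 1 from add_comm _ _]
  | right s =>
    rw [omegaVar, Fin.addCases_right, omegaMul_basis, divPowMul_basis, extMonomial_singleton,
      extGen_mul_extMonomial, Finset.card_singleton, one_mul, sigmaProd_natAdd, raiseCoeff_natAdd,
      raise_natAdd, omegaBasis_apply, inv_inv]
    simp only [starProd, Pi.zero_apply, zero_mul, Finset.sum_const_zero, pow_zero, zero_add,
      qBinom_zero_right, Finset.prod_const_one, one_smul, mul_one]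
    split_ifs
    · simp
    · rw [TensorProduct.tmul_smul, smul_smul, mul_one]

/-- The derivative carries the inverse of the factor in the multiplication by $x_i$; this is why the
products $x_j\partial_{j\pm1}$ normalize. -/
theorem qDeriv_basis (i : Fin (m + n)) : qDeriv q i (omegaBasis q m n a) =
      ((sigmaProd q i a)⁻¹ * lowerCoeff k i a) • omegaBasis q m n (lower i a) := by
  rw [qDeriv, Module.Basis.constr_basis]
  induction i using Fin.addCases with
  | left s =>
    rw [Fin.addCases_left, sigmaProd_castAdd, lowerCoeff, expo_castAdd, lower_castAdd, zpow_neg,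
      zpow_natCast]
    split_ifs <;> simp
  | right s =>
    rw [Fin.addCases_right, sigmaProd_natAdd, lowerCoeff, expo_natAdd, lower_natAdd, zpow_neg,
      zpow_natCast, zpow_neg, zpow_natCast, mul_inv]
    by_cases h : s ∈ a.2 <;> simp [h]

theorem diagOp_basis (c : (Fin m → ℕ) × Finset (Fin n) → k) :
    diagOp q c (omegaBasis q m n a) = c a • omegaBasis q m n a := by
  rw [diagOp, Module.Basis.constr_basis]

/-- The prefix products at $j$ and $j+1$ differ by $\sigma_j$, which the factor $\sigma_j$ of $E_j$
restores. -/
theorem genOp_E_basis {g : Series} (hq : q ≠ 0) (j : Fin (m + n - 1)) :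
    genOp (g := g) q (.E j) (omegaBasis q m n a) =
      moveCoeff q (lowIdx j) (highIdx j) a • omegaBasis q m n (move (lowIdx j) (highIdx j) a) := by
  have hlt : lowIdx j < (highIdx j : Fin (m + n)) := Nat.lt_succ_self j.val
  have h1 : sigmaProd q (lowIdx j) (lower (highIdx j) a) = sigmaProd q (lowIdx j) a :=
    sigmaProd_congr fun s hs => expo_lower_of_ne (hs.trans hlt).ne
  rw [genOp, LinearMap.comp_apply, LinearMap.comp_apply, diagOp_basis, map_smul,
    map_smul, qDeriv_basis, map_smul, omegaVar_mul_basis hq, smul_smul, smul_smul, h1,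
    sigmaEigenvalue_eq, sigmaProd_highIdx, move, moveCoeff]
  congr 1
  have h2 := sigmaProd_ne_zero (a := a) hq (lowIdx j)
  have h3 := sigmaValue_ne_zero (a := a) hq (lowIdx j)
  field_simp

/-- The leftover $\sigma_j$ is taken after $x_j$ has been lowered. Since $\sigma_j^{-1}$ acts last
in $F_j$, it sees the same exponent and cancels exactly. -/
theorem genOp_F_basis {g : Series} (hq : q ≠ 0) (j : Fin (m + n - 1)) :
    genOp (g := g) q (.F j) (omegaBasis q m n a) =
      moveCoeff q (highIdx j) (lowIdx j) a • omegaBasis q m n (move (highIdx j) (lowIdx j) a) := by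
  have hlt : lowIdx j < (highIdx j : Fin (m + n)) := Nat.lt_succ_self j.val
  have h1 : sigmaProd q (lowIdx j) (lower (lowIdx j) a) = sigmaProd q (lowIdx j) a :=
    sigmaProd_congr fun s hs => expo_lower_of_ne hs.ne
  have h4 : sigmaValue q (lowIdx j) (raise (highIdx j) (lower (lowIdx j) a)) =
      sigmaValue q (lowIdx j) (lower (lowIdx j) a) := by
    rw [sigmaValue, sigmaValue, expo_raise_of_ne hlt.ne]
  rw [genOp, LinearMap.comp_apply, LinearMap.comp_apply, qDeriv_basis, map_smul, map_smul,
    omegaVar_mul_basis hq, map_smul, diagOp_basis, smul_smul, smul_smul,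
    sigmaEigenvalue_eq, sigmaProd_highIdx, h1, h4, move, moveCoeff]
  congr 1
  have h2 := sigmaProd_ne_zero (a := a) hq (lowIdx j)
  have h3 := sigmaValue_ne_zero (a := lower (lowIdx j) a) hq (lowIdx j)
  field_simp

/-- The monomial basis identifies the action on `Ω_q(m|n)` with the monomial action. -/
theorem genOp_equiv {V : Type*} [AddCommGroup V] [Module k V]
    (b : Module.Basis ((Fin m → ℕ) × Finset (Fin n)) k V) {g : Series} (hq : q ≠ 0)
    (x : Gen m n g) (v : V) :
    genOp q x (b.equiv (omegaBasis q m n) (Equiv.refl _) v) =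
      b.equiv (omegaBasis q m n) (Equiv.refl _) (monomialAction b q x v) := by
  set e := b.equiv (omegaBasis q m n) (Equiv.refl _)
  have he : ∀ a, e (b a) = omegaBasis q m n a := fun a => by simp [e]
  have : genOp q x ∘ₗ e.toLinearMap = e.toLinearMap ∘ₗ monomialAction b q x := by
    refine b.ext fun a => ?_
    rw [LinearMap.comp_apply, LinearMap.comp_apply, LinearEquiv.coe_coe, he]
    cases x with
    | K γ =>
      rw [genOp, diagOp_basis, monomialAction, diagonalOp_basis, map_smul, he]
    | sigma =>
      rw [genOp, diagOp_basis, monomialAction, diagonalOp_basis, map_smul, he]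
    | E j => rw [genOp_E_basis hq, monomialAction, moveOp_basis, map_smul, he]
    | F j => rw [genOp_F_basis hq, monomialAction, moveOp_basis, map_smul, he]
  exact LinearMap.congr_fun this v

end OmegaAction

/-! ### Saturated monomials and moves below the cap -/

section Combinatorics

/-- A function that vanishes after the first place where it is below the cap is determined by its
sum. -/
theorem eq_of_sum_eq_of_saturated {N : ℕ} {cap f g : Fin N → ℕ} (hcap : ∀ i, 1 ≤ cap i)
    (hf : ∀ i, f i ≤ cap i) (hg : ∀ i, g i ≤ cap i)
    (hf' : ∀ i j : Fin N, i.val + 1 = j.val → f j = 0 ∨ cap i ≤ f i)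
    (hg' : ∀ i j : Fin N, i.val + 1 = j.val → g j = 0 ∨ cap i ≤ g i)
    (h : ∑ i, f i = ∑ i, g i) : f = g := by
  by_contra hne
  obtain ⟨i, hi, hmin⟩ : ∃ i, f i ≠ g i ∧ ∀ s < i, f s = g s := by
    obtain ⟨i, hi⟩ := Function.ne_iff.1 hne
    obtain ⟨i, hi, hmin⟩ := WellFounded.has_min (wellFounded_lt (α := Fin N))
      {i | f i ≠ g i} ⟨i, hi⟩
    exact ⟨i, hi, fun s hs => by_contra fun hs' => hmin s hs' hs⟩
  wlog hlt : f i < g i generalizing f g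
  · exact this hg hf hg' hf' h.symm (Ne.symm hne) hi.symm (fun s hs => (hmin s hs).symm)
      (lt_of_le_of_ne (not_lt.1 hlt) hi.symm)
  -- At the first disagreement $f_i<g_i\le\mathrm{cap}_i$, so $f$ is zero at the next place; as all
  -- caps are positive, a zero entry forces the next to be zero too. Then $f\le g$ throughout,
  -- strictly at $i$.
  have hzero : ∀ r : ℕ, ∀ s : Fin N, s.val = i.val + 1 + r → f s = 0 := by
    intro r
    induction r with
    | zero =>
      intro s hs
      rcases hf' i s hs.symm with h0 | h0
      · exact h0
      · have := hg i; omega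
    | succ r ih =>
      intro s hs
      have hs' := ih ⟨i.val + 1 + r, by have := s.2; omega⟩ rfl
      rcases hf' ⟨i.val + 1 + r, by have := s.2; omega⟩ s (by simp only; omega) with h0 | h0
      · exact h0
      · have := hcap ⟨i.val + 1 + r, by have := s.2; omega⟩
        omega
  refine absurd h (Finset.sum_lt_sum (fun s _ => ?_) ⟨i, Finset.mem_univ _, hlt⟩).ne
  rcases lt_trichotomy s i with hs | hs | hs
  · exact (hmin s hs).le
  · rw [hs]; exact hlt.le
  · rw [hzero (s.val - (i.val + 1)) s (by have := Fin.lt_def.1 hs; omega)]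
    exact Nat.zero_le _

variable {m n : ℕ}

/-- The monomials of degree `t` with even exponents at most `c`. -/
def cappedMonomials (m n c t : ℕ) : Set ((Fin m → ℕ) × Finset (Fin n)) :=
  {a | ∑ i, expo a i = t ∧ ∀ s, a.1 s ≤ c}

/-- The maximal exponents of the monomials in `cappedMonomials`. -/
def expoCap (m n c : ℕ) (i : Fin (m + n)) : ℕ := if i.val < m then c else 1

/-- A monomial in which no unit of exponent can be moved to the left. -/
def IsSaturated (c : ℕ) (a : (Fin m → ℕ) × Finset (Fin n)) : Prop :=
  ∀ j : Fin (m + n - 1), expo a (highIdx j) = 0 ∨ expoCap m n c (lowIdx j) ≤ expo a (lowIdx j)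

/-- The weighted degree that counts the units of exponent with their positions. -/
def depth (a : (Fin m → ℕ) × Finset (Fin n)) : ℕ := ∑ i : Fin (m + n), i.val * expo a i

variable {c t : ℕ} {a a' : (Fin m → ℕ) × Finset (Fin n)}

theorem expo_le_expoCap (h : a ∈ cappedMonomials m n c t) (i : Fin (m + n)) :
    expo a i ≤ expoCap m n c i := by
  rw [expoCap]
  split_ifs with hi
  · induction i using Fin.addCases with
    | left s => rw [expo_castAdd]; exact h.2 s
    | right s => simp at hi
  · exact expo_le_one (not_lt.1 hi)

/-- Uniqueness of the candidate highest weight vector in a given degree. -/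
theorem eq_of_isSaturated (hc : 1 ≤ c) (h : a ∈ cappedMonomials m n c t)
    (h' : a' ∈ cappedMonomials m n c t) (hs : IsSaturated c a) (hs' : IsSaturated c a') :
    a = a' := by
  apply expo_injective
  refine eq_of_sum_eq_of_saturated (cap := expoCap m n c) ?_ (expo_le_expoCap h)
    (expo_le_expoCap h') ?_ ?_ (h.1.trans h'.1.symm)
  · intro i; rw [expoCap]; split_ifs <;> omega
  · intro i j hij
    have := hs ⟨i.val, by have := j.2; omega⟩
    rwa [show highIdx (m := m) (n := n) ⟨i.val, by have := j.2; omega⟩ = j from Fin.ext hij] at this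
  · intro i j hij
    have := hs' ⟨i.val, by have := j.2; omega⟩
    rwa [show highIdx (m := m) (n := n) ⟨i.val, by have := j.2; omega⟩ = j from Fin.ext hij] at this

variable {q : k} {i j : Fin (m + n)}

theorem depth_move (h : i ≠ j) (hc : moveCoeff q i j a ≠ 0) :
    depth (move i j a) + j.val = depth a + i.val := by
  have h1 := expo_move h hc
  have : ∑ s : Fin (m + n), s.val * (expo (move i j a) + Pi.single j 1 : Fin (m + n) → ℕ) s =
      ∑ s : Fin (m + n), s.val * (expo a + Pi.single i 1 : Fin (m + n) → ℕ) s := by rw [h1]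
  simpa [mul_add, Finset.sum_add_distrib, Pi.single_apply, depth] using this

theorem move_injective (h : i ≠ j) (hc : moveCoeff q i j a ≠ 0) (hc' : moveCoeff q i j a' ≠ 0)
    (heq : move i j a = move i j a') : a = a' := by
  have h1 := expo_move h hc
  have h2 := expo_move h hc'
  rw [heq, h2] at h1
  exact expo_injective (add_right_cancel h1).symm

theorem expo_le_of_mem (h : a ∈ cappedMonomials m n c t) (i : Fin (m + n)) : expo a i ≤ t :=
  h.1 ▸ Finset.single_le_sum (f := expo a) (fun _ _ => Nat.zero_le _) (Finset.mem_univ i)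

/-- For an even variable, either the degree is too small to reach the cap, or the coefficient at the
cap is $[c+1]=0$. Odd variables stop at $1$ by themselves. -/
theorem raiseCoeff_eq_zero_of_cap (hqc : t < c ∨ qInt q (c + 1) = 0)
    (h : a ∈ cappedMonomials m n c t) (hi : expoCap m n c i ≤ expo a i) :
    raiseCoeff q i a = 0 := by
  rw [raiseCoeff_eq_ite]
  have h1 := expo_le_expoCap h i
  have h2 := expo_le_of_mem h i
  rw [expoCap] at hi h1
  split_ifs at hi h1 ⊢ with h3 h4
  · rcases hqc with hqc | hqc
    · omega
    · rwa [show expo a i = c by omega]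
  · omega
  · rfl

theorem raiseCoeff_lower_of_ne (h : i ≠ j) : raiseCoeff q i (lower j a) = raiseCoeff q i a := by
  rw [raiseCoeff_eq_ite, raiseCoeff_eq_ite, expo_lower_of_ne h]

theorem move_mem_cappedMonomials (hqc : t < c ∨ qInt q (c + 1) = 0) (hij : i ≠ j)
    (h : a ∈ cappedMonomials m n c t) (hm : moveCoeff q i j a ≠ 0) :
    move i j a ∈ cappedMonomials m n c t := by
  have h1 := expo_move hij hm
  constructor
  · have : ∑ s : Fin (m + n), (expo (move i j a) + Pi.single j 1 : Fin (m + n) → ℕ) s =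
      ∑ s : Fin (m + n), (expo a + Pi.single i 1 : Fin (m + n) → ℕ) s := by rw [h1]
    simp only [Pi.add_apply, Finset.sum_add_distrib, Finset.sum_pi_single', Finset.mem_univ,
      if_true, h.1] at this
    omega
  · intro s
    have h2 := congrFun h1 (Fin.castAdd n s)
    rw [Pi.add_apply, Pi.add_apply, expo_castAdd, expo_castAdd] at h2
    have h3 := h.2 s
    by_cases hi : Fin.castAdd n s = i
    · subst hi
      have h4 : a.1 s ≠ c := by
        intro h4
        apply hm
        rw [moveCoeff, raiseCoeff_lower_of_ne hij, raiseCoeff_eq_zero_of_cap hqc h, mul_zero]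
        rw [expoCap, Fin.val_castAdd, if_pos s.2, expo_castAdd, h4]
      rw [Pi.single_eq_same] at h2
      omega
    · rw [Pi.single_eq_of_ne hi] at h2
      omega

theorem moveCoeff_ne_zero (hne : ∀ r, 1 ≤ r → r ≤ c → qInt q r ≠ 0) (hij : i ≠ j)
    (hj : expo a j ≠ 0) (hi : expo a i < expoCap m n c i) : moveCoeff q i j a ≠ 0 := by
  rw [moveCoeff, raiseCoeff_lower_of_ne hij, lowerCoeff, if_neg hj, one_mul, raiseCoeff_eq_ite]
  rw [expoCap] at hi
  split_ifs at hi ⊢ with h1 h2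
  · exact hne _ (by omega) (by omega)
  · exact one_ne_zero
  · omega

/-- After the move the source is below its cap and the target is positive, so no coefficient of the
way back can vanish. -/
theorem moveCoeff_reverse (hne : ∀ r, 1 ≤ r → r ≤ c → qInt q r ≠ 0) (hij : i ≠ j)
    (h : a ∈ cappedMonomials m n c t) (hm : moveCoeff q i j a ≠ 0) :
    moveCoeff q j i (move i j a) ≠ 0 ∧ move j i (move i j a) = a := by
  have h1 := expo_move hij hm
  have hi := congrFun h1 i
  have hj := congrFun h1 j
  simp only [Pi.add_apply, Pi.single_eq_same, Pi.single_eq_of_ne hij,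
    Pi.single_eq_of_ne hij.symm] at hi hj
  have h2 : moveCoeff q j i (move i j a) ≠ 0 :=
    moveCoeff_ne_zero hne hij.symm (by omega) (by have := expo_le_expoCap h j; omega)
  refine ⟨h2, expo_injective ?_⟩
  have h3 := expo_move hij.symm h2
  rw [h1] at h3
  exact add_right_cancel h3

end Combinatorics

/-! ### Simplicity of the capped components -/

section Simplicity

variable {m n : ℕ} {V : Type*} [AddCommGroup V] [Module k V]
  (b : Module.Basis ((Fin m → ℕ) × Finset (Fin n)) k V) {q : k} {i j : Fin (m + n)} {c t : ℕ}
  {g : Series} {R : FreeAlgebra k (Gen m n g) → FreeAlgebra k (Gen m n g) → Prop}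

theorem moveOp_mem_span {s s' : Set ((Fin m → ℕ) × Finset (Fin n))}
    (h : ∀ a ∈ s, moveCoeff q i j a ≠ 0 → move i j a ∈ s') {v : V}
    (hv : v ∈ Submodule.span k (b '' s)) : moveOp b q i j v ∈ Submodule.span k (b '' s') := by
  induction hv using Submodule.span_induction with
  | mem v hv =>
    obtain ⟨a, ha, rfl⟩ := hv
    rw [moveOp_basis]
    by_cases hc : moveCoeff q i j a = 0
    · rw [hc, zero_smul]; exact Submodule.zero_mem _
    · exact Submodule.smul_mem _ _ (Submodule.subset_span ⟨_, h a ha hc, rfl⟩)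
  | zero => rw [map_zero]; exact Submodule.zero_mem _
  | add x y _ _ hx hy => rw [map_add]; exact Submodule.add_mem _ hx hy
  | smul r x _ hx => rw [map_smul]; exact Submodule.smul_mem _ _ hx

theorem diagonalOp_mem_span {s : Set ((Fin m → ℕ) × Finset (Fin n))}
    (d : (Fin m → ℕ) × Finset (Fin n) → k) {v : V}
    (hv : v ∈ Submodule.span k (b '' s)) : diagonalOp b d v ∈ Submodule.span k (b '' s) := by
  induction hv using Submodule.span_induction with
  | mem v hv =>
    obtain ⟨a, ha, rfl⟩ := hv
    rw [diagonalOp_basis]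
    exact Submodule.smul_mem _ _ (Submodule.subset_span ⟨_, ha, rfl⟩)
  | zero => rw [map_zero]; exact Submodule.zero_mem _
  | add x y _ _ hx hy => rw [map_add]; exact Submodule.add_mem _ hx hy
  | smul r x _ hx => rw [map_smul]; exact Submodule.smul_mem _ _ hx

/-- Moves with nonzero coefficient are injective on monomials, so no other monomial contributes to
this coordinate. -/
theorem coord_moveOp (hij : i ≠ j) {a : (Fin m → ℕ) × Finset (Fin n)}
    (hc : moveCoeff q i j a ≠ 0) (v : V) :
    b.coord (move i j a) (moveOp b q i j v) = moveCoeff q i j a * b.coord a v := by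
  have : b.coord (move i j a) ∘ₗ moveOp b q i j = moveCoeff q i j a • b.coord a := by
    refine b.ext fun a' => ?_
    rw [LinearMap.comp_apply, moveOp_basis, map_smul, LinearMap.smul_apply, b.coord_apply,
      b.coord_apply, b.repr_self, b.repr_self, smul_eq_mul, smul_eq_mul]
    by_cases h : a' = a
    · subst h; rw [Finsupp.single_eq_same, Finsupp.single_eq_same]
    · rw [Finsupp.single_eq_of_ne (Ne.symm h), mul_zero]
      by_cases hc' : moveCoeff q i j a' = 0
      · rw [hc', zero_mul]
      · rw [Finsupp.single_eq_of_ne fun he => h (move_injective hij hc' hc he.symm), mul_zero]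
  exact LinearMap.congr_fun this v

variable (ρ : QAlg R →ₐ[k] Module.End k V)
  (hρ : ∀ x, ρ (QAlg.gen R x) = monomialAction b q x) {w : (Fin m → ℕ) × Finset (Fin n)}
  (hc : 1 ≤ c) (hne : ∀ r, 1 ≤ r → r ≤ c → qInt q r ≠ 0) (hqc : t < c ∨ qInt q (c + 1) = 0)
  (hw : w ∈ cappedMonomials m n c t) (hws : IsSaturated c w)

include hc hne hw hws in
theorem exists_moveCoeff_ne_zero {a : (Fin m → ℕ) × Finset (Fin n)}
    (ha : a ∈ cappedMonomials m n c t) (haw : a ≠ w) :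
    ∃ j : Fin (m + n - 1), moveCoeff q (lowIdx j) (highIdx j) a ≠ 0 := by
  have : ¬ IsSaturated c a := fun h => haw (eq_of_isSaturated hc ha hw h hws)
  rw [IsSaturated] at this
  push Not at this
  obtain ⟨j, h1, h2⟩ := this
  exact ⟨j, moveCoeff_ne_zero hne (lowIdx_ne_highIdx j) h1 h2⟩

include hρ hc hne hqc hw hws

/-- Induction on a bound for the depth of the monomials that occur: an $E_j$ that moves one monomial
other than $w$ keeps the vector nonzero and lowers every depth by one. -/
theorem exists_map_eq_top (B : ℕ) : ∀ v : V,
    v ∈ Submodule.span k (b '' {a | a ∈ cappedMonomials m n c t ∧ depth a < B}) → v ≠ 0 →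
      ∃ u, ρ u v = b w := by
  induction B with
  | zero =>
    intro v hv hv0
    simp only [Nat.not_lt_zero, and_false, Set.ofPred_false, Set.image_empty, Submodule.span_empty,
      Submodule.mem_bot] at hv
    exact absurd hv hv0
  | succ B ih =>
    intro v hv hv0
    by_cases h : ∃ a, a ≠ w ∧ b.coord a v ≠ 0
    · obtain ⟨a, haw, hav⟩ := h
      have ha := (b.mem_span_image.1 hv) (Finsupp.mem_support_iff.2 hav)
      obtain ⟨j, hj⟩ := exists_moveCoeff_ne_zero hc hne hw hws ha.1 haw
      have hlh := lowIdx_ne_highIdx j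
      obtain ⟨u, hu⟩ := ih (moveOp b q (lowIdx j) (highIdx j) v)
        (moveOp_mem_span b (fun a ha hm => by
          refine ⟨move_mem_cappedMonomials hqc hlh ha.1 hm, ?_⟩
          have h1 := depth_move hlh hm
          have h2 : (highIdx j).val = (lowIdx j).val + 1 := rfl
          have h3 := ha.2
          omega) hv)
        (fun h0 => by
          have := coord_moveOp b hlh hj v
          rw [h0, map_zero] at this
          exact mul_ne_zero hj hav this.symm)
      refine ⟨u * QAlg.gen R (.E j), ?_⟩
      rw [map_mul, Module.End.mul_apply, hρ]
      exact hu
    -- Only $w$ occurs in $v$, so a scalar suffices.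
    · push Not at h
      have hv' : v = b.coord w v • b w := by
        apply b.ext_elem
        intro a
        rw [map_smul, b.repr_self, Finsupp.smul_apply, smul_eq_mul]
        by_cases haw : a = w
        · subst haw; rw [Finsupp.single_eq_same, mul_one]; rfl
        · rw [Finsupp.single_eq_of_ne haw, mul_zero]; exact h a haw
      have hw0 : b.coord w v ≠ 0 := fun h0 => hv0 (by rw [hv', h0, zero_smul])
      refine ⟨algebraMap k _ (b.coord w v)⁻¹, ?_⟩
      rw [AlgHom.commutes, Module.algebraMap_end_apply]
      nth_rewrite 2 [hv']
      rw [smul_smul, inv_mul_cancel₀ hw0, one_smul]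

/-- Raise the monomial by some $E_j$, reach the result from $w$ by induction on depth, and undo the
move by $F_j$. -/
theorem exists_map_top_eq (B : ℕ) : ∀ a ∈ cappedMonomials m n c t, depth a < B →
    ∃ u, ρ u (b w) = b a := by
  induction B with
  | zero => intro a _ h; omega
  | succ B ih =>
    intro a ha hB
    by_cases haw : a = w
    · subst haw; exact ⟨1, by rw [map_one, Module.End.one_apply]⟩
    obtain ⟨j, hj⟩ := exists_moveCoeff_ne_zero hc hne hw hws ha haw
    have hlh := lowIdx_ne_highIdx j
    have h1 := depth_move hlh hj
    have h2 : (highIdx j).val = (lowIdx j).val + 1 := rfl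
    obtain ⟨u, hu⟩ := ih _ (move_mem_cappedMonomials hqc hlh ha hj) (by omega)
    obtain ⟨h3, h4⟩ := moveCoeff_reverse hne hlh ha hj
    set d := moveCoeff q (highIdx j) (lowIdx j) (move (lowIdx j) (highIdx j) a)
    refine ⟨algebraMap k _ d⁻¹ * (QAlg.gen R (.F j) * u), ?_⟩
    rw [map_mul, map_mul, AlgHom.commutes, Module.End.mul_apply, Module.End.mul_apply, hu, hρ,
      monomialAction, moveOp_basis, h4, Module.algebraMap_end_apply, smul_smul,
      inv_mul_cancel₀ h3, one_smul]

theorem isSimpleModule_of_monomialAction (hR : ∀ {x y}, QRel q m n g x y → R x y) :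
    IsSimpleModule (QAlg R) (SimpleHW R q (monomialWeight w)) ∧
      ∃ φ : SimpleHW R q (monomialWeight w) →ₗ[k] V, Function.Injective φ ∧
        LinearMap.range φ = Submodule.span k (b '' cappedMonomials m n c t) ∧
        ∀ (x : Gen m n g) (v : SimpleHW R q (monomialWeight w)),
          φ (QAlg.gen R x • v) = monomialAction b q x (φ v) := by
  have hE : ∀ j : Fin (m + n - 1), moveCoeff q (lowIdx j) (highIdx j) w = 0 := by
    intro j
    rw [moveCoeff, raiseCoeff_lower_of_ne (lowIdx_ne_highIdx j)]
    rcases hws j with h | h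
    · rw [lowerCoeff, if_pos h, zero_mul]
    · rw [raiseCoeff_eq_zero_of_cap hqc hw h, mul_zero]
  -- A move by $F_j$ into $w$ would be reversible, contradicting $E_jw=0$. Hence the coordinate of
  -- $w$ is the separating functional.
  have hF : ∀ (j : Fin (m + n - 1)) a, a ∈ cappedMonomials m n c t →
      moveCoeff q (highIdx j) (lowIdx j) a ≠ 0 → move (highIdx j) (lowIdx j) a ≠ w := by
    intro j a ha hm h
    have := (moveCoeff_reverse hne (lowIdx_ne_highIdx j).symm ha hm).1
    rw [h] at this
    exact this (hE j)
  have hmem : ∀ a ∈ cappedMonomials m n c t,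
      b a ∈ Submodule.span k (b '' cappedMonomials m n c t) :=
    fun a ha => Submodule.subset_span ⟨a, ha, rfl⟩
  have key := simpleHW_of_representation hR ρ (monomialWeight w)
    (Submodule.span k (b '' cappedMonomials m n c t)) (b w) (b.coord w) (hmem w hw) ?_ ?_ ?_ ?_ ?_
    ?_ ?_ ?_
  · simpa only [hρ] using key
  · intro x y hy
    rw [hρ]
    cases x with
    | E j =>
      exact moveOp_mem_span b
        (fun a ha hm => move_mem_cappedMonomials hqc (lowIdx_ne_highIdx j) ha hm) hy
    | F j =>
      exact moveOp_mem_span b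
        (fun a ha hm => move_mem_cappedMonomials hqc (lowIdx_ne_highIdx j).symm ha hm) hy
    | K γ => exact diagonalOp_mem_span b _ hy
    | sigma => exact diagonalOp_mem_span b _ hy
  · intro j
    rw [hρ, monomialAction, moveOp_basis, hE, zero_smul]
  · intro γ
    rw [hρ, monomialAction, diagonalOp_basis]
  · rw [hρ, monomialAction, diagonalOp_basis, oddDegree_monomialWeight, zpow_natCast]
  · rw [b.coord_apply, b.repr_self, Finsupp.single_eq_same]
    exact one_ne_zero
  · intro j y hy
    rw [hρ]
    have := moveOp_mem_span (q := q) (i := highIdx j) (j := lowIdx j) b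
      (s' := {a | a ≠ w}) (fun a ha hm => hF j a ha hm) hy
    by_contra hne0
    exact (b.mem_span_image.1 this) (Finsupp.mem_support_iff.2 hne0) rfl
  · intro y hy
    induction hy using Submodule.span_induction with
    | mem y hy =>
      obtain ⟨a, ha, rfl⟩ := hy
      exact exists_map_top_eq b ρ hρ hc hne hqc hw hws _ a ha (Nat.lt_succ_self _)
    | zero => exact ⟨0, by rw [map_zero, LinearMap.zero_apply]⟩
    | add x y _ _ hx hy =>
      obtain ⟨u, hu⟩ := hx
      obtain ⟨u', hu'⟩ := hy
      exact ⟨u + u', by rw [map_add, LinearMap.add_apply, hu, hu']⟩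
    | smul d x _ hx =>
      obtain ⟨u, hu⟩ := hx
      exact ⟨d • u, by rw [map_smul, LinearMap.smul_apply, hu]⟩
  · intro y hy hy0
    -- The bound is one more than the largest depth in the support.
    refine exists_map_eq_top b ρ hρ hc hne hqc hw hws ((b.repr y).support.sup depth + 1) y ?_ hy0
    rw [b.mem_span_image]
    intro a ha
    exact ⟨(b.mem_span_image.1 hy) ha, Nat.lt_succ_of_le (Finset.le_sup (f := depth) ha)⟩

end Simplicity

/-- The argument runs on any space with a basis indexed by monomials and is carried to
$\Omega_q(m|n)$ along the monomial basis, so the tensor product enters only through `genOp_equiv`.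
-/
theorem isSimpleOfHighestWeight_span {m n : ℕ} {V : Type*} [AddCommGroup V] [Module k V]
    (b : Module.Basis ((Fin m → ℕ) × Finset (Fin n)) k V) {q : k} {c t : ℕ}
    {g : Series} {R : FreeAlgebra k (Gen m n g) → FreeAlgebra k (Gen m n g) → Prop}
    {w : (Fin m → ℕ) × Finset (Fin n)} (hc : 1 ≤ c) (hne : ∀ r, 1 ≤ r → r ≤ c → qInt q r ≠ 0)
    (hqc : t < c ∨ qInt q (c + 1) = 0) (hw : w ∈ cappedMonomials m n c t) (hws : IsSaturated c w)
    (hq : q ≠ 0) (hR : ∀ {x y}, QRel q m n g x y → R x y)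
    (hact : ∀ {x y}, R x y → FreeAlgebra.lift k (monomialAction b q) x =
      FreeAlgebra.lift k (monomialAction b q) y) :
    IsSimpleOfHighestWeight R q (monomialWeight w)
      (Submodule.span k (omegaBasis q m n '' cappedMonomials m n c t)) := by
  let ρ : QAlg R →ₐ[k] Module.End k V :=
    RingQuot.liftAlgHom k ⟨FreeAlgebra.lift k (monomialAction b q), fun _ _ h => hact h⟩
  have hρ : ∀ x, ρ (QAlg.gen R x) = monomialAction b q x := fun x =>
    (RingQuot.liftAlgHom_mkAlgHom_apply k _ _ _).trans (FreeAlgebra.lift_ι_apply _ _)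
  obtain ⟨h1, φ, h2, h3, h4⟩ :=
    isSimpleModule_of_monomialAction b ρ hρ hc hne hqc hw hws hR
  let e := b.equiv (omegaBasis q m n) (Equiv.refl _)
  refine ⟨h1, e.toLinearMap ∘ₗ φ, e.injective.comp h2, ?_, ?_⟩
  · rw [LinearMap.range_comp, h3, Submodule.map_span, ← Set.image_comp]
    congr 1
    refine Set.image_congr fun a _ => ?_
    simp [e]
  · intro x v
    rw [LinearMap.comp_apply, h4]
    exact (genOp_equiv b hq x (φ v)).symm

/-! ### Counting capped monomials -/

section Counting

/-- The functions `Fin m → ℕ` bounded by `c` with sum `u`. -/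
def boundedCompositions (m c u : ℕ) : Finset (Fin m → ℕ) :=
  (Fintype.piFinset fun _ => Finset.range (c + 1)).filter fun β => ∑ i, β i = u

theorem mem_boundedCompositions {m c u : ℕ} {β : Fin m → ℕ} :
    β ∈ boundedCompositions m c u ↔ (∀ i, β i ≤ c) ∧ ∑ i, β i = u := by
  simp [boundedCompositions, Fintype.mem_piFinset]

theorem coeff_geom_sum_pow (m c u : ℕ) :
    PowerSeries.coeff u ((∑ i ∈ Finset.range (c + 1), (PowerSeries.X : PowerSeries ℤ) ^ i) ^ m) =
      (boundedCompositions m c u).card := by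
  have h1 : ∀ r : ℕ, PowerSeries.coeff r (∑ i ∈ Finset.range (c + 1),
      (PowerSeries.X : PowerSeries ℤ) ^ i) = if r ≤ c then 1 else 0 := by
    intro r
    simp [PowerSeries.coeff_X_pow]
  have h2 : (∑ i ∈ Finset.range (c + 1), (PowerSeries.X : PowerSeries ℤ) ^ i) ^ m =
      ∏ _j : Fin m, ∑ i ∈ Finset.range (c + 1), (PowerSeries.X : PowerSeries ℤ) ^ i := by
    rw [Finset.prod_const, Finset.card_univ, Fintype.card_fin]
  rw [h2, PowerSeries.coeff_prod]
  simp only [h1]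
  have h3 : ∀ l : Fin m →₀ ℕ, (∏ i, if l i ≤ c then (1 : ℤ) else 0) =
      if ∀ i, l i ≤ c then 1 else 0 := by
    intro l
    rw [Finset.prod_ite_zero]
    simp
  simp only [h3]
  rw [← Finset.sum_filter, Finset.sum_const, nsmul_eq_mul, mul_one, Nat.cast_inj]
  refine Finset.card_bij (fun l _ => ⇑l) ?_ ?_ ?_
  · intro l hl
    rw [Finset.mem_filter, Finset.mem_finsuppAntidiag] at hl
    exact mem_boundedCompositions.2 ⟨hl.2, hl.1.1⟩
  · intro l _ l' _ h
    exact DFunLike.coe_injective h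
  · intro β hβ
    rw [mem_boundedCompositions] at hβ
    refine ⟨Finsupp.equivFunOnFinite.symm β, ?_, rfl⟩
    rw [Finset.mem_filter, Finset.mem_finsuppAntidiag]
    exact ⟨⟨hβ.2, Finset.subset_univ _⟩, hβ.1⟩

/-- Compare coefficients in $(1+X+\dots+X^c)^m=(1-X^{c+1})^m(1-X)^{-m}$, expanding the first factor
binomially. -/
theorem card_boundedCompositions {m : ℕ} (hm : 1 ≤ m) (c s : ℕ) :
    ((boundedCompositions m c s).card : ℤ) = ∑ i ∈ Finset.range (s / (c + 1) + 1),
      (-1) ^ i * (m.choose i : ℤ) * ((m + s - i * (c + 1) - 1).choose (m - 1) : ℤ) := by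
  obtain ⟨d, rfl⟩ := Nat.exists_eq_add_of_le' hm
  set G : PowerSeries ℤ := (PowerSeries.invOneSubPow ℤ (d + 1)).val with hG
  have hGc : ∀ r, PowerSeries.coeff r G = ((d + r).choose d : ℤ) := by
    intro r
    rw [hG, PowerSeries.invOneSubPow_val_succ_eq_mk_add_choose, PowerSeries.coeff_mk]
  have hG1 : (1 - PowerSeries.X : PowerSeries ℤ) ^ (d + 1) * G = 1 := by
    rw [← PowerSeries.invOneSubPow_inv_eq_one_sub_pow, hG]
    exact (PowerSeries.invOneSubPow ℤ (d + 1)).inv_val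
  have hgeom : (∑ i ∈ Finset.range (c + 1), (PowerSeries.X : PowerSeries ℤ) ^ i) ^ (d + 1) =
      (-PowerSeries.X ^ (c + 1) + 1) ^ (d + 1) * G := by
    have h := geom_sum_mul_neg (PowerSeries.X : PowerSeries ℤ) (c + 1)
    rw [neg_add_eq_sub, ← h, mul_pow, mul_assoc, hG1, mul_one]
  rw [← coeff_geom_sum_pow, hgeom, add_pow, Finset.sum_mul, map_sum]
  have hterm : ∀ i, PowerSeries.coeff s ((-(PowerSeries.X : PowerSeries ℤ) ^ (c + 1)) ^ i *
      1 ^ (d + 1 - i) * ((d + 1).choose i : PowerSeries ℤ) * G) =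
      if i * (c + 1) ≤ s then (-1) ^ i * ((d + 1).choose i : ℤ) *
        ((d + 1 + s - i * (c + 1) - 1).choose d : ℤ) else 0 := by
    intro i
    rw [neg_pow, ← pow_mul, one_pow, mul_one, show ((-1 : PowerSeries ℤ) ^ i *
      PowerSeries.X ^ ((c + 1) * i) * ((d + 1).choose i : PowerSeries ℤ) * G) =
      PowerSeries.X ^ ((c + 1) * i) *
        (PowerSeries.C ((-1) ^ i * ((d + 1).choose i : ℤ)) * G) by
      rw [map_mul, map_pow, map_neg, map_one, map_natCast]; ring,
      PowerSeries.coeff_X_pow_mul', PowerSeries.coeff_C_mul, hGc, mul_comm (c + 1) i]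
    split_ifs with h
    · rw [show d + (s - i * (c + 1)) = d + 1 + s - i * (c + 1) - 1 by omega]
    · rfl
  simp only [hterm]
  rw [Nat.add_sub_cancel]
  have hdiv : ∀ i, i * (c + 1) ≤ s ↔ i < s / (c + 1) + 1 := fun i => by
    rw [Nat.lt_succ_iff, Nat.le_div_iff_mul_le (Nat.succ_pos c)]
  simp only [hdiv]
  rw [← Finset.sum_filter]
  -- The binomial sum stops at $i=m$, the stated one at $\lfloor s/(c+1)\rfloor$; terms with $i>m$
  -- have $\binom mi=0$.
  refine Finset.sum_subset_zero_on_sdiff ?_ ?_ fun _ _ => rfl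
  · intro i hi
    exact Finset.mem_range.2 (Finset.mem_filter.1 hi).2
  · intro i hi
    rw [Finset.mem_sdiff, Finset.mem_filter, Finset.mem_range, Finset.mem_range] at hi
    rw [Nat.choose_eq_zero_of_lt (n := d + 1) (k := i) (by
      by_contra h; exact hi.2 ⟨by omega, hi.1⟩)]
    simp

/-- The cap is not reached before it matters, so only the term $i=0$ survives. -/
theorem card_boundedCompositions_of_le {m : ℕ} (hm : 1 ≤ m) {c s : ℕ} (h : s ≤ c) :
    (boundedCompositions m c s).card = (m + s - 1).choose s := by
  have := card_boundedCompositions hm c s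
  rw [Nat.div_eq_of_lt (by omega)] at this
  simp only [zero_add, Finset.range_one, Finset.sum_singleton, pow_zero, Nat.choose_zero_right,
    Nat.cast_one, zero_mul, Nat.sub_zero, mul_one, one_mul, Nat.cast_inj] at this
  rw [this, ← Nat.choose_symm (by omega)]
  congr 1
  omega

/-- The finite set of monomials of degree `t` with even exponents at most `c`. -/
def cappedMonomialsFinset (m n c t : ℕ) : Finset ((Fin m → ℕ) × Finset (Fin n)) :=
  ((Fintype.piFinset fun _ => Finset.range (c + 1)) ×ˢ Finset.univ).filter
    fun a => ∑ i, a.1 i + a.2.card = t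

theorem sum_expo {m n : ℕ} (a : (Fin m → ℕ) × Finset (Fin n)) :
    ∑ i, expo a i = ∑ i, a.1 i + a.2.card := by
  rw [Fin.sum_univ_add]
  simp

theorem coe_cappedMonomialsFinset (m n c t : ℕ) :
    (cappedMonomialsFinset m n c t : Set _) = cappedMonomials m n c t := by
  ext a
  simp only [cappedMonomialsFinset, Finset.coe_filter, Finset.mem_product, Fintype.mem_piFinset,
    Finset.mem_range, Finset.mem_univ, and_true, Set.mem_ofPred_eq, cappedMonomials, sum_expo,
    Nat.lt_succ_iff]
  exact and_comm

theorem card_cappedMonomialsFinset (m n c t : ℕ) :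
    (cappedMonomialsFinset m n c t).card = ∑ s ∈ Finset.range (min t n + 1),
      n.choose s * (boundedCompositions m c (t - s)).card := by
  rw [cappedMonomialsFinset, Finset.card_filter, Finset.sum_product_right]
  -- The guard $s\le t$ keeps the truncated difference $t-s$ from counting odd parts of too large
  -- degree.
  let f : ℕ → ℕ := fun s => if s ≤ t then (boundedCompositions m c (t - s)).card else 0
  have h : ∀ μ : Finset (Fin n), (∑ β ∈ Fintype.piFinset fun _ : Fin m => Finset.range (c + 1),
      if ∑ i, β i + μ.card = t then 1 else 0) = f μ.card := by
    intro μ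
    rw [← Finset.card_filter]
    simp only [f]
    split_ifs with hs
    · rw [boundedCompositions]
      congr 1
      exact Finset.filter_congr fun β _ => by omega
    · exact Finset.card_eq_zero.2 (Finset.filter_eq_empty_iff.2 fun β _ => by omega)
  rw [Finset.sum_congr rfl fun μ _ => h μ, ← Finset.powerset_univ,
    Finset.sum_powerset_apply_card f, Finset.card_univ, Fintype.card_fin]
  symm
  refine Finset.sum_subset_zero_on_sdiff ?_ ?_ ?_
  · intro s hs
    rw [Finset.mem_range] at *
    omega
  · intro s hs
    rw [Finset.mem_sdiff, Finset.mem_range, Finset.mem_range] at hs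
    simp only [f]
    rw [if_neg (by omega), smul_zero]
  · intro s hs
    rw [Finset.mem_range] at hs
    simp only [f]
    rw [if_pos (by omega), smul_eq_mul]

theorem finrank_span_basis_image {ι V : Type*} [AddCommMonoid V] [Module k V]
    (b : Module.Basis ι k V) (s : Finset ι) :
    Module.finrank k (Submodule.span k (b '' (s : Set ι))) = s.card := by
  have h := b.linearIndependent.comp (Subtype.val : s → ι) Subtype.val_injective
  have := Module.finrank_eq_card_basis (Module.Basis.span h)
  rw [Set.range_comp, Subtype.range_coe_subtype] at this
  simpa using this

end Counting

/-! ### Graded components as spans of monomials -/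

section Degrees

variable (q : k) (m n : ℕ)

/-- The predicate on even exponents lets one proof serve the full and the restricted algebra. -/
theorem iSup_map₂_eq_span (P : (Fin m → ℕ) → Prop) (t : ℕ) :
    (⨆ p ∈ Finset.HasAntidiagonal.antidiagonal t,
      Submodule.map₂ (TensorProduct.mk k (DivPow k m) (QExterior q⁻¹ n))
        (Submodule.span k {w | ∃ β : Fin m → ℕ, P β ∧ ∑ i, β i = p.1 ∧ w = divPowBasis k m β})
        (extDeg q⁻¹ n p.2)) =
      Submodule.span k (omegaBasis q m n '' {a | ∑ i, expo a i = t ∧ P a.1}) := by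
  apply le_antisymm
  · refine iSup₂_le fun p hp => ?_
    rw [extDeg, Submodule.map₂_span_span, Submodule.span_le]
    rintro _ ⟨_, ⟨β, hβ, hs, rfl⟩, _, ⟨μ, hμ, rfl⟩, rfl⟩
    refine Submodule.subset_span ⟨(β, μ), ⟨?_, hβ⟩, omegaBasis_apply q _⟩
    rw [sum_expo, hs, hμ]
    exact Finset.HasAntidiagonal.mem_antidiagonal.1 hp
  · rw [Submodule.span_le]
    rintro _ ⟨a, ⟨ha, hP⟩, rfl⟩
    rw [sum_expo] at ha
    refine Submodule.mem_iSup_of_mem (∑ i, a.1 i, a.2.card) (Submodule.mem_iSup_of_mem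
      (Finset.HasAntidiagonal.mem_antidiagonal.2 ha) ?_)
    rw [omegaBasis_apply]
    exact Submodule.apply_mem_map₂ _ (Submodule.subset_span ⟨a.1, hP, rfl, rfl⟩)
      (Submodule.subset_span ⟨a.2, rfl, rfl⟩)

theorem restrictedOmegaDeg_eq_span (ℓ t : ℕ) : restrictedOmegaDeg q ℓ m n t =
    Submodule.span k (omegaBasis q m n '' cappedMonomials m n (ℓ - 1) t) :=
  iSup_map₂_eq_span q m n (fun β => ∀ i, β i ≤ ℓ - 1) t

/-- No exponent exceeds the total degree, so a cap of at least $t$ excludes nothing. -/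
theorem omegaDeg_eq_span {c t : ℕ} (h : t ≤ c) : omegaDeg q m n t =
    Submodule.span k (omegaBasis q m n '' cappedMonomials m n c t) := by
  have h1 := iSup_map₂_eq_span q m n (fun _ => True) t
  simp only [true_and, and_true] at h1
  refine h1.trans ?_
  congr 2
  ext a
  refine ⟨fun ha => ⟨ha, fun s => ?_⟩, fun ha => ha.1⟩
  have := Finset.single_le_sum (f := expo a) (fun _ _ => Nat.zero_le _)
    (Finset.mem_univ (Fin.castAdd n s))
  rw [expo_castAdd] at this
  exact (this.trans ha.le).trans h

theorem restrictedDivPowDeg_eq_span (k : Type*) [Field k] (ℓ m t : ℕ) :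
    restrictedDivPowDeg k ℓ m t =
      Submodule.span k (divPowBasis k m '' (boundedCompositions m (ℓ - 1) t : Set _)) := by
  rw [restrictedDivPowDeg]
  congr 1
  ext w
  constructor
  · rintro ⟨β, h1, h2, rfl⟩
    exact ⟨β, mem_boundedCompositions.2 ⟨h1, h2⟩, rfl⟩
  · rintro ⟨β, h, rfl⟩
    obtain ⟨h1, h2⟩ := mem_boundedCompositions.1 h
    exact ⟨β, h1, h2, rfl⟩

end Degrees

/-! ### The highest monomials and their weights -/

section Tops

variable {m n : ℕ}

/-- The monomial with the first `d` exponents equal to `c`, the next one equal to `r`. -/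
def evenTop (m n c d r : ℕ) : (Fin m → ℕ) × Finset (Fin n) :=
  (fun s => if s.val < d then c else if s.val = d then r else 0, ∅)

theorem expo_evenTop {c d r : ℕ} (hd : d < m) (i : Fin (m + n)) : expo (evenTop m n c d r) i =
    if i.val < d then c else if i.val = d then r else 0 := by
  induction i using Fin.addCases with
  | left s => simp [evenTop]
  | right s =>
    have h1 : ¬ m + s.val < d := by omega
    have h2 : ¬ m + s.val = d := by omega
    simp [evenTop, h1, h2]

theorem evenTop_mem {c d r : ℕ} (hd : d < m) (hr : r ≤ c) :
    evenTop m n c d r ∈ cappedMonomials m n c (d * c + r) := by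
  constructor
  · rw [sum_expo]
    simp only [evenTop, Finset.card_empty, add_zero]
    rw [Fin.sum_univ_eq_sum_range (fun s => if s < d then c else if s = d then r else 0) m]
    obtain ⟨e, rfl⟩ := Nat.exists_eq_add_of_lt hd
    rw [add_right_comm, Finset.sum_range_add, Finset.sum_range_succ,
      Finset.sum_congr rfl fun s hs => if_pos (Finset.mem_range.1 hs)]
    simp only [Finset.sum_const, Finset.card_range, smul_eq_mul, lt_irrefl, if_false, if_true]
    rw [Finset.sum_eq_zero fun s _ => by rw [if_neg (by omega), if_neg (by omega)], add_zero]
  · intro s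
    simp only [evenTop]
    split_ifs <;> omega

theorem isSaturated_evenTop {c d r : ℕ} (hd : d < m) : IsSaturated c (evenTop m n c d r) := by
  intro j
  have h : (highIdx j : Fin (m + n)).val = j.val + 1 := rfl
  have h' : (lowIdx j : Fin (m + n)).val = j.val := rfl
  rw [expo_evenTop hd, expo_evenTop hd, expoCap, h, h']
  by_cases hj : j.val < d
  · right
    rw [if_pos hj, if_pos (by omega)]
  · left
    rw [if_neg (by omega), if_neg (by omega)]

theorem monomialWeight_evenTop {c d r : ℕ} (hd : d < m) : monomialWeight (evenTop m n c d r) =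
    ((c : ℤ) - r) • fundWeight m n d + (r : ℤ) • fundWeight m n (d + 1) := by
  funext i
  rw [monomialWeight_eq_expo, expo_evenTop hd]
  simp only [Pi.add_apply, Pi.smul_apply, fundWeight, smul_eq_mul]
  rcases lt_trichotomy i.val d with h | h | h
  · rw [if_pos h, if_pos h, if_pos (by omega)]; ring
  · rw [if_neg (by omega), if_pos h, if_neg (by omega), if_pos (by omega)]; ring
  · rw [if_neg (by omega), if_neg (by omega), if_neg (by omega), if_neg (by omega)]; simp

/-- The monomial with all even exponents equal to `c` and the first `p` odd exponents equal to
`1`. -/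
def oddTop (m n c p : ℕ) : (Fin m → ℕ) × Finset (Fin n) :=
  (fun _ => c, Finset.univ.filter fun s => s.val < p)

theorem expo_oddTop {c p : ℕ} (i : Fin (m + n)) : expo (oddTop m n c p) i =
    if i.val < m then c else if i.val < m + p then 1 else 0 := by
  induction i using Fin.addCases with
  | left s => simp [oddTop]
  | right s => simp [oddTop]

theorem oddTop_mem {c p : ℕ} (hp : p ≤ n) :
    oddTop m n c p ∈ cappedMonomials m n c (m * c + p) := by
  refine ⟨?_, fun s => le_rfl⟩
  rw [sum_expo]
  simp only [oddTop, Finset.sum_const, Finset.card_univ, Fintype.card_fin, smul_eq_mul]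
  rw [Fin.card_filter_val_lt, min_eq_right hp]

theorem isSaturated_oddTop {c p : ℕ} : IsSaturated c (oddTop m n c p) := by
  intro j
  have h : (highIdx j : Fin (m + n)).val = j.val + 1 := rfl
  have h' : (lowIdx j : Fin (m + n)).val = j.val := rfl
  rw [expo_oddTop, expo_oddTop, expoCap, h, h']
  split_ifs <;> omega

/-- One of the $c$ units on each even variable joins the odd units to form $\omega_{m+p}$; $c-1$
copies of $\omega_m$ remain. -/
theorem monomialWeight_oddTop {c p : ℕ} : monomialWeight (oddTop m n c p) =
    ((c : ℤ) - 1) • fundWeight m n m + fundWeight m n (m + p) := by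
  funext i
  rw [monomialWeight_eq_expo, expo_oddTop]
  simp only [Pi.add_apply, Pi.smul_apply, fundWeight, smul_eq_mul]
  by_cases h : i.val < m
  · rw [if_pos h, if_pos h, if_pos (by omega)]; ring
  · rw [if_neg h, if_neg h]; simp

end Tops

/-! ### Dimensions, and vanishing of $q$-integers in terms of $\mathbf{char}(q)$ -/

theorem IsSimpleOfHighestWeight.finrank_eq {m n : ℕ} {g : Series}
    {R : FreeAlgebra k (Gen m n g) → FreeAlgebra k (Gen m n g) → Prop} {q : k}
    {wt : Fin (m + n) → ℤ} {S : Submodule k (Omega q m n)}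
    (h : IsSimpleOfHighestWeight R q wt S) :
    Module.finrank k S = Module.finrank k (SimpleHW R q wt) := by
  obtain ⟨-, φ, h1, rfl, -⟩ := h
  exact (LinearEquiv.ofInjective φ h1).finrank_eq.symm

theorem qInt_ne_zero_of_qChar_eq_zero {q : k} (h : qChar q = 0) {r : ℕ} (hr : 1 ≤ r) :
    qInt q r ≠ 0 := by
  intro h0
  have := (Nat.sInf_mem (s := {l : ℕ | 1 ≤ l ∧ qInt q l = 0}) ⟨r, hr, h0⟩).1
  rw [qChar] at h
  omega

theorem qInt_qChar {q : k} (h : qChar q ≠ 0) : qInt q (qChar q) = 0 :=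
  (Nat.sInf_mem (Nat.nonempty_of_pos_sInf (Nat.pos_of_ne_zero h))).2

theorem qInt_ne_zero_of_lt_qChar {q : k} {r : ℕ} (hr : 1 ≤ r) (h : r < qChar q) : qInt q r ≠ 0 :=
  fun h0 => Nat.notMem_of_lt_sInf h ⟨hr, h0⟩

theorem finite_span_basis_image {ι V : Type*} [AddCommMonoid V] [Module k V]
    (b : Module.Basis ι k V) (s : Finset ι) :
    Module.Finite k (Submodule.span k (b '' (s : Set ι))) :=
  Module.Finite.span_of_finite k (s.finite_toSet.image b)

theorem finrank_span_omegaBasis (q : k) (m n c t : ℕ) :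
    Module.Finite k (Submodule.span k (omegaBasis q m n '' cappedMonomials m n c t)) ∧
    Module.finrank k (Submodule.span k (omegaBasis q m n '' cappedMonomials m n c t)) =
      ∑ s ∈ Finset.range (min t n + 1), n.choose s * (boundedCompositions m c (t - s)).card := by
  rw [← coe_cappedMonomialsFinset]
  exact ⟨finite_span_basis_image _ _,
    (finrank_span_basis_image _ _).trans (card_cappedMonomialsFinset m n c t)⟩

end QGrassmann

/-! ### The generic and the restricted case -/

open QGrassmann in
theorem corollary29 {k : Type*} [Field k] [IsAlgClosed k] [CharZero k]
    (m n t : ℕ) (hm : 1 ≤ m) (q : k) (hq : q ≠ 0) (hq2 : q ^ 2 ≠ 1) (g : Series) :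
    (qChar q = 0 →
      IsSimpleOfHighestWeight (QRel q m n g) q ((t : ℤ) • fundWeight m n 1)
        (omegaDeg q m n t) ∧
      Module.Finite k (omegaDeg q m n t) ∧
      Module.finrank k (omegaDeg q m n t) =
        Module.finrank k (SimpleHW (QRel q m n g) q ((t : ℤ) • fundWeight m n 1)) ∧
      (t ≤ n → Module.finrank k (omegaDeg q m n t) =
        ∑ s ∈ Finset.range (t + 1), (m + t - s - 1).choose (t - s) * n.choose s) ∧
      (n < t → Module.finrank k (omegaDeg q m n t) =
        ∑ s ∈ Finset.range (n + 1), (m + t - s - 1).choose (t - s) * n.choose s)) ∧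
    (∀ ℓ : ℕ, qChar q = ℓ → 3 ≤ ℓ →
      (∀ i r : ℕ, 1 ≤ i → i ≤ m → r ≤ ℓ - 1 → t = (i - 1) * (ℓ - 1) + r →
        IsSimpleOfHighestWeight (RestrictedQRel q ℓ m n g) q
          (((ℓ : ℤ) - 1 - r) • fundWeight m n (i - 1) + (r : ℤ) • fundWeight m n i)
          (restrictedOmegaDeg q ℓ m n t) ∧
        Module.finrank k (restrictedOmegaDeg q ℓ m n t) =
          Module.finrank k (SimpleHW (RestrictedQRel q ℓ m n g) q
            (((ℓ : ℤ) - 1 - r) • fundWeight m n (i - 1) + (r : ℤ) • fundWeight m n i))) ∧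
      (∀ p : ℕ, p ≤ n → t = m * (ℓ - 1) + p →
        IsSimpleOfHighestWeight (RestrictedQRel q ℓ m n g) q
          (((ℓ : ℤ) - 2) • fundWeight m n m + fundWeight m n (m + p))
          (restrictedOmegaDeg q ℓ m n t) ∧
        Module.finrank k (restrictedOmegaDeg q ℓ m n t) =
          Module.finrank k (SimpleHW (RestrictedQRel q ℓ m n g) q
            (((ℓ : ℤ) - 2) • fundWeight m n m + fundWeight m n (m + p)))) ∧
      Module.Finite k (restrictedOmegaDeg q ℓ m n t) ∧
      (t ≤ n → Module.finrank k (restrictedOmegaDeg q ℓ m n t) =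
        ∑ s ∈ Finset.range (t + 1),
          n.choose s * Module.finrank k (restrictedDivPowDeg k ℓ m (t - s))) ∧
      (n < t → Module.finrank k (restrictedOmegaDeg q ℓ m n t) =
        ∑ s ∈ Finset.range (n + 1),
          n.choose s * Module.finrank k (restrictedDivPowDeg k ℓ m (t - s))) ∧
      (∀ s : ℕ, Module.Finite k (restrictedDivPowDeg k ℓ m s) ∧
        (Module.finrank k (restrictedDivPowDeg k ℓ m s) : ℤ) =
          ∑ i ∈ Finset.range (s / ℓ + 1),
            (-1) ^ i * (m.choose i : ℤ) * ((m + s - i * ℓ - 1).choose (m - 1) : ℤ))) := by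
  constructor
  · intro h0
    -- The cap is $t+1$ rather than $t$: it must be strictly above the degree, and at least $1$ even
    -- for $t=0$.
    have hdeg : omegaDeg q m n t = _ := omegaDeg_eq_span q m n (Nat.le_succ t)
    have hs : IsSimpleOfHighestWeight (QRel q m n g) q ((t : ℤ) • fundWeight m n 1)
        (omegaDeg q m n t) := by
      have h1 : monomialWeight (evenTop m n (t + 1) 0 t) = (t : ℤ) • fundWeight m n 1 := by
        rw [monomialWeight_evenTop hm, show fundWeight m n 0 = 0 from funext fun i => by
          simp [fundWeight]]
        simp
      have h2 := evenTop_mem (n := n) (c := t + 1) hm (Nat.le_succ t)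
      rw [zero_mul, zero_add] at h2
      rw [hdeg, ← h1]
      exact isSimpleOfHighestWeight_span Finsupp.basisSingleOne (Nat.succ_pos t)
        (fun r hr _ => qInt_ne_zero_of_qChar_eq_zero h0 hr) (Or.inl (Nat.lt_succ_self t)) h2
        (isSaturated_evenTop hm) hq (fun h => h) (monomialAction_rel _ hq hq2)
    have hdim := finrank_span_omegaBasis q m n (t + 1) t
    rw [← hdeg] at hdim
    have hterm : ∀ N, N ≤ t → ∑ s ∈ Finset.range (N + 1),
        n.choose s * (boundedCompositions m (t + 1) (t - s)).card =
        ∑ s ∈ Finset.range (N + 1), (m + t - s - 1).choose (t - s) * n.choose s := by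
      intro N hN
      refine Finset.sum_congr rfl fun s hs => ?_
      rw [Finset.mem_range] at hs
      rw [card_boundedCompositions_of_le hm (by omega), mul_comm,
        show m + (t - s) - 1 = m + t - s - 1 by omega]
    refine ⟨hs, hdim.1, hs.finrank_eq, fun h => ?_, fun h => ?_⟩
    · rw [hdim.2, min_eq_left h, hterm t le_rfl]
    · rw [hdim.2, min_eq_right h.le, hterm n h.le]
  · intro ℓ hℓ h3
    have hℓ0 : qInt q ℓ = 0 := hℓ ▸ qInt_qChar (by omega)
    have hne : ∀ r, 1 ≤ r → r ≤ ℓ - 1 → qInt q r ≠ 0 := fun r hr hr' =>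
      qInt_ne_zero_of_lt_qChar hr (by omega)
    -- With cap $\ell-1$ the alternative used is $[c+1]=[\ell]=0$.
    have hqc : t < ℓ - 1 ∨ qInt q (ℓ - 1 + 1) = 0 := Or.inr (by
      rwa [Nat.sub_add_cancel (by omega)])
    have hdeg : restrictedOmegaDeg q ℓ m n t = _ := restrictedOmegaDeg_eq_span q m n ℓ t
    have hsimple : ∀ w ∈ cappedMonomials m n (ℓ - 1) t, IsSaturated (ℓ - 1) w →
        IsSimpleOfHighestWeight (RestrictedQRel q ℓ m n g) q (monomialWeight w)
          (restrictedOmegaDeg q ℓ m n t) := by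
      intro w hw hws
      rw [hdeg]
      exact isSimpleOfHighestWeight_span Finsupp.basisSingleOne (by omega) hne hqc hw hws hq
        RestrictedQRel.base (monomialAction_restricted_rel _ hq hq2 (by omega) hℓ0)
    have hcast : ((ℓ - 1 : ℕ) : ℤ) = (ℓ : ℤ) - 1 := by
      rw [Nat.cast_sub (by omega), Nat.cast_one]
    have hdiv : ∀ s, Module.Finite k (restrictedDivPowDeg k ℓ m s) ∧
        Module.finrank k (restrictedDivPowDeg k ℓ m s) =
          (boundedCompositions m (ℓ - 1) s).card := by
      intro s
      rw [restrictedDivPowDeg_eq_span]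
      exact ⟨finite_span_basis_image _ _, finrank_span_basis_image _ _⟩
    have hdim := finrank_span_omegaBasis q m n (ℓ - 1) t
    rw [← hdeg] at hdim
    refine ⟨?_, ?_, hdim.1, ?_, ?_, ?_⟩
    · intro i r hi him hr ht
      -- Here $d=i-1$ is the number of even variables filled to the cap before the partially filled
      -- one.
      obtain ⟨d, rfl⟩ := Nat.exists_eq_add_of_le' hi
      rw [Nat.add_sub_cancel] at ht ⊢
      have hw : monomialWeight (evenTop m n (ℓ - 1) d r) = ((ℓ : ℤ) - 1 - r) • fundWeight m n d +
          (r : ℤ) • fundWeight m n (d + 1) := by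
        rw [monomialWeight_evenTop him, hcast]
      have := hsimple _ (ht ▸ evenTop_mem him hr) (isSaturated_evenTop him)
      rw [hw] at this
      exact ⟨this, this.finrank_eq⟩
    · intro p hp ht
      have hw : monomialWeight (oddTop m n (ℓ - 1) p) =
          ((ℓ : ℤ) - 2) • fundWeight m n m + fundWeight m n (m + p) := by
        rw [monomialWeight_oddTop, hcast, sub_sub]
        rfl
      have := hsimple _ (ht ▸ oddTop_mem hp) isSaturated_oddTop
      rw [hw] at this
      exact ⟨this, this.finrank_eq⟩
    · intro h
      rw [hdim.2, min_eq_left h]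
      exact Finset.sum_congr rfl fun s _ => by rw [(hdiv _).2]
    · intro h
      rw [hdim.2, min_eq_right h.le]
      exact Finset.sum_congr rfl fun s _ => by rw [(hdiv _).2]
    · intro s
      refine ⟨(hdiv s).1, ?_⟩
      rw [(hdiv s).2, card_boundedCompositions hm, Nat.sub_add_cancel (by omega)]
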